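/- **Vectorial data.** Let $V$ be a finite-dimensional real vector space, $(\alpha_i)_{i\in I}$ a finite linearly independent family in $V^*$ and $(\alpha_i^\vee)_{i\in I}$ a family in $V$ with $\alpha_i(\alpha_i^\vee)=2$. Put $r_i(v)=v-\alpha_i(v)\alpha_i^\vee$ and $W^v=\langle r_i\mid i\in I\rangle\subset GL(V)$. Assume that $(W^v,S)$, $S=\{r_i\}$, is a Coxeter system (with length $\ell$) whose Coxeter matrix consists of the orders of the $r_ir_j$, and that the set of real roots $\Phi=\{w\alpha_i\mid w\in W^v,i\in I\}$ has the usual properties: $r_\alpha=wr_iw^{-1}$, of the form $v\mapsto v-\alpha(v)\alpha^\vee$, depends only on $\alpha=w\alpha_i$; with $\Phi^+=\Phi\cap\sum_i\mathbb R_{\ge0}\alpha_i$ one has $\Phi=\Phi^+\sqcup-\Phi^+$; only $1\in W^v$ stabilizes $\Phi^+$; $w\alpha_i\in\Phi^+\Leftrightarrow\ell(wr_i)>\ell(w)$; and $\Phi\cap\mathbb R_{\ge0}\alpha=\{\alpha\}$ for $\alpha\in\Phi$. For $J\subset I$ let $F^v(J)=\{v\mid\alpha_i(v)=0\ (i\in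 J),\ \alpha_i(v)>0\ (i\notin J)\}$ and $C^v_f=F^v(\emptyset)$. The vectorial facets (chambers) of sign $\varepsilon=\pm1$ are the $\varepsilon wF^v(J)$ (the $\varepsilon wC^v_f$), $w\in W^v$; such a facet is spherical if $\langle r_i\mid i\in J\rangle$ is finite. The Tits cone $\mathcal T$ is the union of the positive vectorial facets. Let $\Delta_{im}\subset V^*\setminus\{0\}$ be a set of imaginary roots, disjoint from $\mathbb R\Phi$ and stable under $\pm W^v$, in the moderately imaginary case: with $\Delta_{im}^+=\Delta_{im}\cap\sum_i\mathbb R_{\ge0}\alpha_i$, one has $\Delta_{im}=\Delta_{im}^+\cup-\Delta_{im}^+$, and $\Delta_{im}^+$ is $W^v$-stable. Put $\Delta=\Phi\cup\Delta_{im}$. **Model apartment.** Let $\mathbb A$ be an affine space under $V$, identified with $V$ by the choice of an origin, with a set $\mathcal M$ of walls, each of the form $M(\alpha,k)=\{\alpha+k=0\}$ with $\alpha\in\Phi$, $k\in\mathbb R$. Put $\Gamma_\alpha=\{k\mid M(\alpha,k)\in\mathcal M\}$ for $\alpha\in\Phi$ and $\Gamma_\alpha=\mathbb R$ for $\alpha\in\Delta_{im}$.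 Assume that $\Gamma_\alpha$ is infinite for $\alpha\in\Phi$ and that the group $W$ generated by the reflections $v\mapsto v-(\alpha(v)+k)\alpha^\vee$ in the walls stabilizes $\mathcal M$. Let $D(\alpha,k)=\{\alpha+k\ge0\}$, $D^\circ(\alpha,k)=\{\alpha+k>0\}$ and $D(\alpha,\infty)=\mathbb A$. A set $\Omega$ contains a filter $F$ if $\Omega\in F$; a subset is identified with the filter of the sets containing it; $F\cup F'$ is the filter of the sets belonging to both $F$ and $F'$; a map fixes $F$ if it fixes some element of $F$ pointwise. * The enclosure $cl(F)$ of a filter $F$ consists of the sets containing some element of $F$ of the form $\bigcap_{\alpha\in\Delta}D(\alpha,k_\alpha)$, $k_\alpha\in\Gamma_\alpha\cup\{\infty\}$. * For $x\in\mathbb A$ and a vectorial facet $F_0^v$, the facet $F(x,F_0^v)$ consists of the sets containing an intersection of half-spaces, one half-space $D(\alpha,k_\alpha)$ or $D^\circ(\alpha,k_\alpha)$ with $k_\alpha\in\Gamma_\alpha\cup\{\infty\}$ for each $\alpha\in\Delta$, that contains a neighbourhood of $x$ in $x+F_0^v$. * The chimney with base a facet $F$ and direction a vectorial facet $F^v$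 is $cl(F+F^v)$. Its germ consists of the sets containing $cl(F+\xi+F^v)$ for some $\xi\in\overline{F^v}$. It (and its germ) is splayed if $F^v$ is spherical, and solid if the direction of the smallest affine subspace containing it has a finite pointwise stabilizer in $W^v$. * A preordered interval germ is the germ at $x$ of $]x,y]$, where $x\ne y$ and $y-x\in\pm\mathcal T$. A generic half-line is $x+\mathbb R_{\ge0}v$ with $v\ne0$ in a spherical vectorial facet. * The sector germ of direction a vectorial chamber $C^v$ is the filter $germ_\infty(C^v)$ of the sets containing a translate of $C^v$. **Affine hovels.** An affine hovel of type $\mathbb A$ is a non-empty set $\mathcal I$ covered by a set $\mathcal A$ of subsets (apartments), such that: * (MA1) Each $A\in\mathcal A$ carries a non-empty set $Isom(\mathbb A,A)$ of bijections $\mathbb A\to A$ that is a single orbit $f_0\circ W$. An isomorphism $\varphi:A\to A'$ of apartments is a bijection with $\varphi\circ f\in Isom(\mathbb A,A')$ for $f\in Isom(\mathbb A,A)$, and the notions above are transported to $A$. * (MA2) If $F$ is a point, a preordered interval germ, a generic half-line or a solid chimney of $A$, and $A'$ is an apartment containing $F$, then $A\cap A'$ contains $cl_A(F)$ and there is an isomorphism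 $A\to A'$ fixing $cl_A(F)$. * (MA3) If $\mathfrak R$ is a splayed chimney germ and $F$ a facet or a solid chimney germ (possibly in different apartments), then some apartment contains both. * (MA4) If two apartments $A,A'$ contain $\mathfrak R$ and $F$ as in (MA3), then $A\cap A'$ contains $cl_A(\mathfrak R\cup F)$ and there is an isomorphism $A\to A'$ fixing $cl_A(\mathfrak R\cup F)$. The sector germs of sign $\varepsilon$ of $\mathcal I$ are the filters $f(germ_\infty(\varepsilon wC^v_f))$ on $\mathcal I$, for $A\in\mathcal A$, $f\in Isom(\mathbb A,A)$, $w\in W^v$; they are the chambers of $\mathcal I^{+\infty}$ ($\varepsilon=+1$) and of $\mathcal I^{-\infty}$ ($\varepsilon=-1$). **Theorem.** Let $\mathcal I$ be an affine hovel. (1) Any two sector germs $\mathfrak Q_1,\mathfrak Q_2$ of signs $\varepsilon_1,\varepsilon_2\in\{\pm1\}$ are contained in a common apartment. For every apartment $A$ containing both and every $f\in Isom(\mathbb A,A)$, there are $w_1,w_2\in W^v$ with $\mathfrak Q_j=f(germ_\infty(\varepsilon_jw_jC^v_f))$, and $w_1^{-1}w_2\in W^v$ does not depend on the choices of $A,f,w_1,w_2$.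 Denote it by $d_+(\mathfrak Q_1,\mathfrak Q_2)$ if $\varepsilon_1=\varepsilon_2=+1$, by $d_-(\mathfrak Q_1,\mathfrak Q_2)$ if $\varepsilon_1=\varepsilon_2=-1$, and by $d_*(\mathfrak Q_1,\mathfrak Q_2)$ (the codistance) if $\varepsilon_1=-\varepsilon_2$. (2) $(\mathcal I^{+\infty},d_+)$ and $(\mathcal I^{-\infty},d_-)$ are buildings of type $(W^v,S)$, i.e. the sets of chambers are non-empty and, for $d=d_\pm$, all chambers $x,y,z$ and $s\in S$: $d(x,y)=1\Leftrightarrow x=y$; if $d(y,z)=s$ and $w=d(x,y)$, then $d(x,z)\in\{w,ws\}$, and $d(x,z)=ws$ if $\ell(ws)>\ell(w)$; and there is a $z$ with $d(y,z)=s$ and $d(x,z)=d(x,y)s$. (3) $d_*$ is a twinning of $(\mathcal I^{+\infty},d_+)$ and $(\mathcal I^{-\infty},d_-)$: for $\varepsilon\in\{+,-\}$, $x\in\mathcal I^{\varepsilon\infty}$, $y\in\mathcal I^{-\varepsilon\infty}$ chambers, $w=d_*(x,y)$ and $s\in S$, one has $d_*(y,x)=w^{-1}$; if $z\in\mathcal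 I^{-\varepsilon\infty}$ satisfies $d_{-\varepsilon}(y,z)=s$ and $\ell(ws)<\ell(w)$, then $d_*(x,z)=ws$; and there is a chamber $z\in\mathcal I^{-\varepsilon\infty}$ with $d_{-\varepsilon}(y,z)=s$ and $d_*(x,z)=ws$. -/

import Mathlib

open Filter Topology

noncomputable section

/-! ### Vectorial Weyl group, roots, vectorial facets -/

/-- Simple roots `α_i` (a free family in the dual) and simple coroots `α_i^∨`, with
`α_i(α_i^∨) = 2`. -/
structure RootBasis (V ι : Type*) [AddCommGroup V] [Module ℝ V] where
  root : ι → Module.Dual ℝ V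
  coroot : ι → V
  root_coroot_two : ∀ i, root i (coroot i) = 2
  linearIndependent_root : LinearIndependent ℝ root

namespace RootBasis

variable {V ι : Type*} [AddCommGroup V] [Module ℝ V] (B : RootBasis V ι)

/-- The simple reflection `r_i(v) = v - α_i(v) α_i^∨`. -/
def refl (i : ι) : V ≃ₗ[ℝ] V := Module.reflection (B.root_coroot_two i)

/-- The vectorial Weyl group `W^v`. -/
def weyl : Subgroup (V ≃ₗ[ℝ] V) := Subgroup.closure (Set.range B.refl)

theorem refl_mem (i : ι) : B.refl i ∈ B.weyl :=
  Subgroup.subset_closure (Set.mem_range_self i)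

/-- The simple reflection, as an element of `W^v`. -/
def simpleRefl (i : ι) : B.weyl := ⟨B.refl i, B.refl_mem i⟩

/-- The contragredient action of `GL(V)` on the dual: `(w α)(v) = α(w⁻¹ v)`. -/
def dualAct (w : V ≃ₗ[ℝ] V) (a : Module.Dual ℝ V) : Module.Dual ℝ V :=
  a.comp (w.symm : V →ₗ[ℝ] V)

/-- `a` is a real root `w(α_i)`, and `c` the corresponding coroot `w(α_i^∨)`; the reflection
`r_a = w r_i w⁻¹` is `v ↦ v - a(v) c`. -/
def IsRootPair (a : Module.Dual ℝ V) (c : V) : Prop :=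
  ∃ w ∈ B.weyl, ∃ i, a = dualAct w (B.root i) ∧ c = w (B.coroot i)

/-- The set `Φ` of real roots. -/
def roots : Set (Module.Dual ℝ V) := {a | ∃ w ∈ B.weyl, ∃ i, a = dualAct w (B.root i)}

/-- The cone `⨁ ℝ⁺ α_i` in the dual. -/
def posCone [Fintype ι] : Set (Module.Dual ℝ V) :=
  {a | ∃ c : ι → ℝ, (∀ i, 0 ≤ c i) ∧ a = ∑ i, c i • B.root i}

/-- The set `Φ⁺` of positive roots. -/
def posRoots [Fintype ι] : Set (Module.Dual ℝ V) := B.roots ∩ B.posCone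

/-- The standard vectorial facet `F^v(J)`; `F^v(∅)` is the fundamental chamber `C^v_f`. -/
def stdFacet (J : Set ι) : Set V :=
  {v | (∀ i ∈ J, B.root i v = 0) ∧ ∀ i ∉ J, 0 < B.root i v}

/-- The vectorial facet `ε w F^v(J)`, of sign `ε = ±1`. -/
def facet (ε : ℤˣ) (w : V ≃ₗ[ℝ] V) (J : Set ι) : Set V :=
  (fun v => ε • w v) '' B.stdFacet J

/-- The vectorial chamber `ε w C^v_f`. -/
def chamber (ε : ℤˣ) (w : V ≃ₗ[ℝ] V) : Set V := B.facet ε w ∅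

/-- `J` is spherical if the group generated by the `r_i`, `i ∈ J`, is finite. -/
def IsSphericalType (J : Set ι) : Prop :=
  (Subgroup.closure (B.refl '' J) : Set (V ≃ₗ[ℝ] V)).Finite

/-- Vectorial facets (positive or negative). -/
def IsVecFacet (F : Set V) : Prop :=
  ∃ ε : ℤˣ, ∃ w ∈ B.weyl, ∃ J : Set ι, F = B.facet ε w J

/-- Spherical vectorial facets (positive or negative). -/
def IsSphericalVecFacet (F : Set V) : Prop :=
  ∃ ε : ℤˣ, ∃ w ∈ B.weyl, ∃ J : Set ι, B.IsSphericalType J ∧ F = B.facet ε w J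

/-- The Tits cone: the union of the positive vectorial facets. -/
def titsCone : Set V := {v | ∃ w ∈ B.weyl, ∃ J : Set ι, v ∈ B.facet 1 w J}

end RootBasis

/-- The quadruple `(V, W^v, (α_i), (α_i^∨))` with its standing properties. -/
structure VectorialWeylData (V ι : Type*) [AddCommGroup V] [Module ℝ V] [Fintype ι]
    extends RootBasis V ι where
  /-- The Coxeter matrix of `W^v`. -/
  cox : CoxeterMatrix ι
  /-- `W^v`, with the generators `r_i`, is a Coxeter group. -/
  cs : CoxeterSystem cox toRootBasis.weyl
  cs_simple : ∀ i, cs.simple i = toRootBasis.simpleRefl i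
  cox_eq_orderOf : ∀ i j,
    cox.M i j = orderOf (toRootBasis.simpleRefl i * toRootBasis.simpleRefl j)
  /-- The reflection `r_α = w r_i w⁻¹` depends only on the root `α = w(α_i)`. -/
  refl_wellDefined : ∀ w ∈ toRootBasis.weyl, ∀ w' ∈ toRootBasis.weyl, ∀ i j,
    RootBasis.dualAct w (root i) = RootBasis.dualAct w' (root j) →
      w * toRootBasis.refl i * w⁻¹ = w' * toRootBasis.refl j * w'⁻¹
  /-- `Φ = Φ⁺ ⊔ Φ⁻` with `Φ⁻ = -Φ⁺`. -/
  roots_eq : toRootBasis.roots = toRootBasis.posRoots ∪ {a | -a ∈ toRootBasis.posRoots}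
  disjoint_roots : Disjoint toRootBasis.posRoots {a | -a ∈ toRootBasis.posRoots}
  eq_one_of_stabilizes : ∀ w ∈ toRootBasis.weyl,
    RootBasis.dualAct w '' toRootBasis.posRoots = toRootBasis.posRoots → w = 1
  pos_iff_length : ∀ (w : toRootBasis.weyl) (i : ι),
    RootBasis.dualAct (w : V ≃ₗ[ℝ] V) (root i) ∈ toRootBasis.posRoots ↔
      cs.length w < cs.length (w * toRootBasis.simpleRefl i)
  /-- `Φ ∩ ℝ⁺ α = {α}` for every real root `α`. -/
  root_multiple : ∀ a ∈ toRootBasis.roots, ∀ t : ℝ, 0 ≤ t → t • a ∈ toRootBasis.roots → t = 1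

/-! ### The model affine apartment -/

/-- The hyperplane `M(α, k) = {v | α(v) + k = 0}`. -/
def affineHyperplane {V : Type*} [AddCommGroup V] [Module ℝ V]
    (a : Module.Dual ℝ V) (k : ℝ) : Set V := {v | a v + k = 0}

/-- The model affine apartment `𝔸`, in the moderately imaginary case. An origin (not assumed to
be special) is chosen in the affine space, which is thus identified with `V`. -/
structure AffineApartment {V ι : Type*} [AddCommGroup V] [Module ℝ V] [Fintype ι]
    (D : VectorialWeylData V ι) where
  /-- The set `Δ_im` of imaginary roots. -/
  imRoots : Set (Module.Dual ℝ V)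
  zero_notMem_imRoots : (0 : Module.Dual ℝ V) ∉ imRoots
  imRoots_disjoint : ∀ a ∈ D.roots, ∀ t : ℝ, t • a ∉ imRoots
  imRoots_neg : ∀ a ∈ imRoots, -a ∈ imRoots
  imRoots_weyl : ∀ w ∈ D.weyl, ∀ a ∈ imRoots, RootBasis.dualAct w a ∈ imRoots
  /-- Moderately imaginary: `Δ_im = Δ_im⁺ ∪ -Δ_im⁺`, where `Δ_im⁺` consists of the imaginary
  roots in `⨁ ℝ⁺ α_i`, and `Δ_im⁺` is stable under `W^v`. -/
  imRoots_subset : ∀ a ∈ imRoots, a ∈ D.posCone ∨ -a ∈ D.posCone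
  imRoots_pos_weyl : ∀ w ∈ D.weyl, ∀ a ∈ imRoots ∩ D.posCone,
    RootBasis.dualAct w a ∈ imRoots ∩ D.posCone
  /-- The set of (real) walls. -/
  walls : Set (Set V)
  walls_direction : ∀ M ∈ walls, ∃ a ∈ D.roots, ∃ k : ℝ, M = affineHyperplane a k
  walls_infinite : ∀ a ∈ D.roots, {k : ℝ | affineHyperplane a k ∈ walls}.Infinite
  /-- The group generated by the reflections in the walls stabilizes the set of walls. -/
  walls_stable : ∀ g ∈ Subgroup.closure {g : V ≃ᵃ[ℝ] V | ∃ a c k, D.IsRootPair a c ∧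
      affineHyperplane a k ∈ walls ∧ ∀ v, g v = v - (a v + k) • c},
    ∀ M ∈ walls, g '' M ∈ walls

namespace AffineApartment

variable {V ι : Type*} [NormedAddCommGroup V] [NormedSpace ℝ V] [Fintype ι]
  {D : VectorialWeylData V ι} (𝔸 : AffineApartment D)

/-- The affine Weyl group `W`, generated by the reflections `r_M`, for `M` a wall. -/
def affWeyl : Subgroup (V ≃ᵃ[ℝ] V) :=
  Subgroup.closure {g : V ≃ᵃ[ℝ] V | ∃ a c k, D.IsRootPair a c ∧
    affineHyperplane a k ∈ 𝔸.walls ∧ ∀ v, g v = v - (a v + k) • c}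

/-- The set `Δ = Φ ∪ Δ_im` of all roots. -/
def allRoots : Set (Module.Dual ℝ V) := D.roots ∪ 𝔸.imRoots

/-- The set `Γ_α` of those `k` for which `M(α, k)` is a real or imaginary wall; all the
hyperplanes of direction `Ker α`, `α` imaginary, are imaginary walls. -/
def levels (a : Module.Dual ℝ V) : Set ℝ :=
  {k | a ∈ 𝔸.imRoots ∨ affineHyperplane a k ∈ 𝔸.walls}

/-- The half-spaces `D(α, k)` with `k ∈ Γ_α ∪ {∞}`. -/
def closedHalves (a : Module.Dual ℝ V) : Set (Set V) :=
  {H | H = Set.univ ∨ ∃ k ∈ 𝔸.levels a, H = {v | 0 ≤ a v + k}}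

/-- The half-spaces `D(α, k)` and `D°(α, k)` with `k ∈ Γ_α ∪ {∞}`. -/
def halves (a : Module.Dual ℝ V) : Set (Set V) :=
  {H | H ∈ 𝔸.closedHalves a ∨ ∃ k ∈ 𝔸.levels a, H = {v | 0 < a v + k}}

theorem closedHalves_inter (a : Module.Dual ℝ V) {H K : Set V}
    (hH : H ∈ 𝔸.closedHalves a) (hK : K ∈ 𝔸.closedHalves a) : H ∩ K ∈ 𝔸.closedHalves a := by
  rcases hH with rfl | ⟨k, hk, rfl⟩
  · simpa using hK
  rcases hK with rfl | ⟨l, hl, rfl⟩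
  · exact Or.inr ⟨k, hk, by simp⟩
  rcases le_total k l with h | h
  · refine Or.inr ⟨k, hk, ?_⟩
    ext v
    simp only [Set.mem_inter_iff, Set.mem_ofPred_eq]
    exact ⟨fun hv => hv.1, fun hv => ⟨hv, by linarith⟩⟩
  · refine Or.inr ⟨l, hl, ?_⟩
    ext v
    simp only [Set.mem_inter_iff, Set.mem_ofPred_eq]
    exact ⟨fun hv => hv.2, fun hv => ⟨by linarith, hv⟩⟩

theorem halves_inter (a : Module.Dual ℝ V) {H K : Set V}
    (hH : H ∈ 𝔸.halves a) (hK : K ∈ 𝔸.halves a) : H ∩ K ∈ 𝔸.halves a := by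
  have key : H ⊆ K ∨ K ⊆ H := by
    rcases hH with (rfl | ⟨k, hk, rfl⟩) | ⟨k, hk, rfl⟩
    · exact Or.inr (Set.subset_univ _)
    all_goals
      rcases hK with (rfl | ⟨l, hl, rfl⟩) | ⟨l, hl, rfl⟩
      · exact Or.inl (Set.subset_univ _)
      all_goals
        rcases lt_trichotomy k l with h | h | h
        · refine Or.inl fun v hv => ?_
          simp only [Set.mem_ofPred_eq] at hv ⊢
          linarith
        · subst h
          first
          | exact Or.inl fun v hv => by
              simp only [Set.mem_ofPred_eq] at hv ⊢
              linarith
          | exact Or.inr fun v hv => by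
              simp only [Set.mem_ofPred_eq] at hv ⊢
              linarith
        · refine Or.inr fun v hv => ?_
          simp only [Set.mem_ofPred_eq] at hv ⊢
          linarith
  rcases key with h | h
  · rwa [Set.inter_eq_left.mpr h]
  · rwa [Set.inter_eq_right.mpr h]

/-- The enclosure `cl(F)` of a filter: the sets containing an element of `F` of the form
`⋂_{α ∈ Δ} D(α, k_α)`, with `k_α ∈ Γ_α ∪ {∞}`. -/
def cl (F : Filter V) : Filter V where
  sets := {S | ∃ c : Module.Dual ℝ V → Set V, (∀ a ∈ 𝔸.allRoots, c a ∈ 𝔸.closedHalves a) ∧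
    (⋂ a ∈ 𝔸.allRoots, c a) ∈ F ∧ (⋂ a ∈ 𝔸.allRoots, c a) ⊆ S}
  univ_sets := ⟨fun _ => Set.univ, fun _ _ => Or.inl rfl, by simp, Set.subset_univ _⟩
  sets_of_superset := by
    rintro S T ⟨c, hc, hF, hS⟩ hST
    exact ⟨c, hc, hF, hS.trans hST⟩
  inter_sets := by
    rintro S T ⟨c, hc, hF, hS⟩ ⟨c', hc', hF', hT⟩
    refine ⟨fun a => c a ∩ c' a, fun a ha => 𝔸.closedHalves_inter a (hc a ha) (hc' a ha), ?_, ?_⟩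
    · filter_upwards [hF, hF'] with v h h'
      simp only [Set.mem_iInter, Set.mem_inter_iff] at h h' ⊢
      exact fun a ha => ⟨h a ha, h' a ha⟩
    · intro v hv
      simp only [Set.mem_iInter, Set.mem_inter_iff] at hv
      exact ⟨hS (by simpa using fun a ha => (hv a ha).1),
        hT (by simpa using fun a ha => (hv a ha).2)⟩

/-- The local facet `F^ℓ(x, F^v)`: the germ at `x` of `x + F^v`. -/
def localFacet (x : V) (Fv : Set V) : Filter V := 𝓝[(fun v => x + v) '' Fv] x

/-- The facet `F(x, F^v)`: the sets containing an intersection of half-spaces `D(α, k_α)` or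
`D°(α, k_α)` (a single one for each `α ∈ Δ`) that contains the local facet. -/
def affFacet (x : V) (Fv : Set V) : Filter V where
  sets := {S | ∃ c : Module.Dual ℝ V → Set V, (∀ a ∈ 𝔸.allRoots, c a ∈ 𝔸.halves a) ∧
    (⋂ a ∈ 𝔸.allRoots, c a) ∈ localFacet x Fv ∧ (⋂ a ∈ 𝔸.allRoots, c a) ⊆ S}
  univ_sets := ⟨fun _ => Set.univ, fun _ _ => Or.inl (Or.inl rfl), by simp, Set.subset_univ _⟩
  sets_of_superset := by
    rintro S T ⟨c, hc, hF, hS⟩ hST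
    exact ⟨c, hc, hF, hS.trans hST⟩
  inter_sets := by
    rintro S T ⟨c, hc, hF, hS⟩ ⟨c', hc', hF', hT⟩
    refine ⟨fun a => c a ∩ c' a, fun a ha => 𝔸.halves_inter a (hc a ha) (hc' a ha), ?_, ?_⟩
    · filter_upwards [hF, hF'] with v h h'
      simp only [Set.mem_iInter, Set.mem_inter_iff] at h h' ⊢
      exact fun a ha => ⟨h a ha, h' a ha⟩
    · intro v hv
      simp only [Set.mem_iInter, Set.mem_inter_iff] at hv
      exact ⟨hS (by simpa using fun a ha => (hv a ha).1),
        hT (by simpa using fun a ha => (hv a ha).2)⟩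

/-- The shortened chimney `cl(F + ξ + F^v)`, with `F = F(x, F₀^v)`. -/
def shortChimney (x : V) (F₀ Fv : Set V) (ξ : V) : Filter V :=
  𝔸.cl (Filter.map₂ (fun u v => u + v) (Filter.map (fun u => u + ξ) (𝔸.affFacet x F₀)) (𝓟 Fv))

/-- The chimney `𝔯(F, F^v) = cl(F + F^v)`, with base `F = F(x, F₀^v)` and direction `F^v`. -/
def chimney (x : V) (F₀ Fv : Set V) : Filter V :=
  𝔸.cl (Filter.map₂ (fun u v => u + v) (𝔸.affFacet x F₀) (𝓟 Fv))

/-- The germ of a chimney: the sets containing one of its shortenings `cl(F + ξ + F^v)`, `ξ` in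
the closure of `F^v` (these filters form a directed family). -/
def chimneyGerm (x : V) (F₀ Fv : Set V) : Filter V :=
  ⨅ ξ ∈ closure Fv, 𝔸.shortChimney x F₀ Fv ξ

/-- The support of a filter: the smallest affine subspace containing it. -/
def support (F : Filter V) : AffineSubspace ℝ V :=
  sInf {E : AffineSubspace ℝ V | (E : Set V) ∈ F}

/-- The chimney `𝔯(F, F^v)` is solid: the direction of its support has a finite pointwise
stabilizer in `W^v`. -/
def ChimneySolid (x : V) (F₀ Fv : Set V) : Prop :=
  {w : V ≃ₗ[ℝ] V | w ∈ D.weyl ∧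
    ∀ v ∈ (support (𝔸.chimney x F₀ Fv)).direction, w v = v}.Finite

/-- Facets of `𝔸`. -/
def IsFacet (F : Filter V) : Prop := ∃ x F₀, D.IsVecFacet F₀ ∧ F = 𝔸.affFacet x F₀

/-- Solid chimneys of `𝔸`. -/
def IsSolidChimney (F : Filter V) : Prop :=
  ∃ x F₀ Fv, D.IsVecFacet F₀ ∧ D.IsVecFacet Fv ∧ 𝔸.ChimneySolid x F₀ Fv ∧
    F = 𝔸.chimney x F₀ Fv

/-- Germs of solid chimneys of `𝔸`. -/
def IsSolidChimneyGerm (F : Filter V) : Prop :=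
  ∃ x F₀ Fv, D.IsVecFacet F₀ ∧ D.IsVecFacet Fv ∧ 𝔸.ChimneySolid x F₀ Fv ∧
    F = 𝔸.chimneyGerm x F₀ Fv

/-- Germs of splayed chimneys of `𝔸` (those with a spherical direction). -/
def IsSplayedChimneyGerm (R : Filter V) : Prop :=
  ∃ x F₀ Fv, D.IsVecFacet F₀ ∧ D.IsSphericalVecFacet Fv ∧ R = 𝔸.chimneyGerm x F₀ Fv

/-- Germs `]x, y)` of preordered intervals: `x ≠ y`, and `x ≤ y` or `y ≤ x`. -/
def IsPreorderedIntervalGerm (D : VectorialWeylData V ι) (F : Filter V) : Prop :=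
  ∃ x y : V, x ≠ y ∧ (y - x ∈ D.titsCone ∨ x - y ∈ D.titsCone) ∧
    F = 𝓝[(fun t : ℝ => x + t • (y - x)) '' Set.Ioc 0 1] x

/-- Generic half-lines: their direction lies in a spherical vectorial facet. -/
def IsGenericHalfLine (D : VectorialWeylData V ι) (F : Filter V) : Prop :=
  ∃ x v : V, v ≠ 0 ∧ (∃ Fv, D.IsSphericalVecFacet Fv ∧ v ∈ Fv) ∧
    F = 𝓟 ((fun t : ℝ => x + t • v) '' Set.Ici 0)

/-- The germ of the sectors of direction `C`: the sets containing a translate of `C` (for a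
vectorial chamber, the translates form a directed family). -/
def sectorGerm (C : Set V) : Filter V := ⨅ x : V, 𝓟 ((fun v => x + v) '' C)

end AffineApartment

/-! ### Affine hovels -/

/-- An affine hovel (masure affine) of type `𝔸` on the set `I`. An isomorphism from the apartment
`A` to the apartment `A'` is a map `φ` with `φ ∘ f ∈ isom A'` for `f ∈ isom A`; a filter of `A` is
handled through its inverse image `F` under a chart `f ∈ isom A`, a subset `A'` of `I` contains it
when `A' ∈ map f F`, and `φ` fixes it when `φ ∘ f` and `f` coincide on some element of `F`. -/
structure AffineHovel {V ι : Type*} [NormedAddCommGroup V] [NormedSpace ℝ V] [Fintype ι]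
    {D : VectorialWeylData V ι} (𝔸 : AffineApartment D) (I : Type*) where
  /-- The set of apartments. -/
  apts : Set (Set I)
  covering : ⋃₀ apts = Set.univ
  /-- The set `Isom(𝔸, A)`, for an apartment `A`. -/
  isom : Set I → Set (V → I)
  isom_nonempty : ∀ A ∈ apts, (isom A).Nonempty
  isom_bijOn : ∀ A ∈ apts, ∀ f ∈ isom A, Function.Injective f ∧ Set.range f = A
  isom_iff : ∀ A ∈ apts, ∀ f₀ ∈ isom A, ∀ f : V → I,
    f ∈ isom A ↔ ∃ w ∈ 𝔸.affWeyl, f = f₀ ∘ w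
  /-- (MA2) -/
  ma2 : ∀ A ∈ apts, ∀ f ∈ isom A, ∀ F : Filter V,
    ((∃ x, F = pure x) ∨ AffineApartment.IsPreorderedIntervalGerm D F ∨
      AffineApartment.IsGenericHalfLine D F ∨ 𝔸.IsSolidChimney F) →
    ∀ A' ∈ apts, A' ∈ map f F →
      A ∩ A' ∈ map f (𝔸.cl F) ∧
      ∃ φ : I → I, φ ∘ f ∈ isom A' ∧ ∀ᶠ x in 𝔸.cl F, φ (f x) = f x
  /-- (MA3) -/
  ma3 : ∀ A₁ ∈ apts, ∀ f₁ ∈ isom A₁, ∀ A₂ ∈ apts, ∀ f₂ ∈ isom A₂, ∀ R F : Filter V,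
    𝔸.IsSplayedChimneyGerm R → (𝔸.IsFacet F ∨ 𝔸.IsSolidChimneyGerm F) →
    ∃ A ∈ apts, A ∈ map f₁ R ∧ A ∈ map f₂ F
  /-- (MA4) -/
  ma4 : ∀ A ∈ apts, ∀ f ∈ isom A, ∀ R F : Filter V,
    𝔸.IsSplayedChimneyGerm R → (𝔸.IsFacet F ∨ 𝔸.IsSolidChimneyGerm F) →
    ∀ A' ∈ apts, A' ∈ map f R → A' ∈ map f F →
      A ∩ A' ∈ map f (𝔸.cl (R ⊔ F)) ∧
      ∃ φ : I → I, φ ∘ f ∈ isom A' ∧ ∀ᶠ x in 𝔸.cl (R ⊔ F), φ (f x) = f x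

namespace AffineHovel

variable {V ι : Type*} [NormedAddCommGroup V] [NormedSpace ℝ V] [Fintype ι]
  {D : VectorialWeylData V ι} {𝔸 : AffineApartment D} {I : Type*} (H : AffineHovel 𝔸 I)

/-- The germ `f(germ_∞(x + ε w C^v_f))`, a filter of subsets of the hovel. -/
def chartGerm (D : VectorialWeylData V ι) {I : Type*} (f : V → I) (ε : ℤˣ) (w : D.weyl) :
    Filter I :=
  map f (AffineApartment.sectorGerm (D.chamber ε (w : V ≃ₗ[ℝ] V)))

/-- The set of sector germs of sign `ε` of the hovel, i.e. the set of chambers of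
`I^{+∞}` (for `ε = 1`) or `I^{-∞}` (for `ε = -1`). -/
def SectorGerm (ε : ℤˣ) : Type _ :=
  {Q : Filter I // ∃ A ∈ H.apts, ∃ f ∈ H.isom A, ∃ w : D.weyl, Q = chartGerm D f ε w}

/-- In the apartment `A` and the chart `f ∈ Isom(𝔸, A)`, the sector germs `Q₁`, `Q₂` have the
directions `ε₁ w₁ C^v_f` and `ε₂ w₂ C^v_f`. -/
def ReadIn {ε₁ ε₂ : ℤˣ} (Q₁ : H.SectorGerm ε₁) (Q₂ : H.SectorGerm ε₂) (A : Set I) (f : V → I)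
    (w₁ w₂ : D.weyl) : Prop :=
  A ∈ H.apts ∧ f ∈ H.isom A ∧ Q₁.1 = chartGerm D f ε₁ w₁ ∧ Q₂.1 = chartGerm D f ε₂ w₂

open Classical in
/-- The element `w₁⁻¹ w₂` computed in some apartment containing both sector germs. -/
def relPos {ε₁ ε₂ : ℤˣ} (Q₁ : H.SectorGerm ε₁) (Q₂ : H.SectorGerm ε₂) : D.weyl :=
  if h : ∃ u : D.weyl, ∃ A f w₁ w₂, H.ReadIn Q₁ Q₂ A f w₁ w₂ ∧ u = w₁⁻¹ * w₂ then h.choose else 1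

/-- The `W^v`-distance `d_ε` on the sector germs of sign `ε`. -/
def dist (ε : ℤˣ) (Q₁ Q₂ : H.SectorGerm ε) : D.weyl := H.relPos Q₁ Q₂

/-- The codistance `d_*(Q₁, Q₂)`, for `Q₁` positive and `Q₂` negative. -/
def codistPosNeg (Q₁ : H.SectorGerm 1) (Q₂ : H.SectorGerm (-1)) : D.weyl := H.relPos Q₁ Q₂

/-- The codistance `d_*(Q₁, Q₂)`, for `Q₁` negative and `Q₂` positive. -/
def codistNegPos (Q₁ : H.SectorGerm (-1)) (Q₂ : H.SectorGerm 1) : D.weyl := H.relPos Q₁ Q₂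

end AffineHovel

/-! ### Buildings and twinnings -/

section Buildings

variable {ι W : Type*} [Group W] {M : CoxeterMatrix ι} (cs : CoxeterSystem M W)

/-- `(C, d)` is a building of type `(W, S)`. -/
structure IsBuilding {C : Type*} (d : C → C → W) : Prop where
  nonempty : Nonempty C
  eq_one_iff : ∀ x y, d x y = 1 ↔ x = y
  adjacent : ∀ x y z i, d y z = cs.simple i →
    (d x z = d x y ∨ d x z = d x y * cs.simple i) ∧
    (cs.length (d x y) < cs.length (d x y * cs.simple i) → d x z = d x y * cs.simple i)
  exists_adjacent : ∀ x y i, ∃ z, d y z = cs.simple i ∧ d x z = d x y * cs.simple i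

/-- The second and third axioms of twinnings, for `x ∈ C` and `y, z ∈ C'`. -/
structure IsHalfTwinning {C C' : Type*} (d' : C' → C' → W) (δ : C → C' → W) : Prop where
  adjacent : ∀ x y z i, d' y z = cs.simple i →
    cs.length (δ x y * cs.simple i) < cs.length (δ x y) → δ x z = δ x y * cs.simple i
  exists_adjacent : ∀ x y i, ∃ z, d' y z = cs.simple i ∧ δ x z = δ x y * cs.simple i

/-- The codistance, given by `δ` on `C × C'` and by `δ'` on `C' × C`, is a twinning between the
buildings `(C, d)` and `(C', d')`. -/
structure IsTwinning {C C' : Type*} (d : C → C → W) (d' : C' → C' → W)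
    (δ : C → C' → W) (δ' : C' → C → W) : Prop where
  building : IsBuilding cs d
  building' : IsBuilding cs d'
  symm : ∀ x y, δ' y x = (δ x y)⁻¹
  half : IsHalfTwinning cs d' δ
  half' : IsHalfTwinning cs d δ'

end Buildings

end

/-!
A panel at infinity is seen from a sector germ `Q` through any apartment containing `Q` and the germ
of a splayed chimney in the direction of the panel (MA3): there `Q` singles out one of the two
chambers of the panel, its projection. By (MA4) the projection depends only on the chimney germ. It
is also independent of the base of the chimney: an alcove-based chimney contains the chimneys based
at all nearby points of its closure, so the projection is locally constant on each side along a line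
transverse to the panel, hence constant. Far out on the two opposite sides of that line the chimneys
lie in the two adjacent sector germs of an apartment, so all the sector germs of the panel see the
same projection, in apartments which they share with `Q`. In such an apartment the relative position
of `Q` to a sector germ of the panel differs from the one to the projection by at most a simple
reflection. This gate property contains the axioms of buildings and of twinnings.
-/

noncomputable section

theorem exists_forall_dual_apply_eq {V ι : Type*} [AddCommGroup V] [Module ℝ V] [Finite ι]
    {r : ι → Module.Dual ℝ V} (hr : LinearIndependent ℝ r) (c : ι → ℝ) : ∃ v, ∀ j, r j v = c j := by
  classical
  cases nonempty_fintype ι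
  suffices h : LinearMap.range (LinearMap.pi r) = ⊤ by
    obtain ⟨v, hv⟩ := LinearMap.range_eq_top.1 h c
    exact ⟨v, congrFun hv⟩
  by_contra h
  obtain ⟨φ, hφ, hrange⟩ := Submodule.exists_le_ker_of_lt_top _ (lt_top_iff_ne_top.2 h)
  refine hφ (LinearMap.pi_ext' fun j => LinearMap.ext_ring ?_)
  refine Fintype.linearIndependent_iff.1 hr (fun j => φ (Pi.single j 1)) ?_ j
  ext v
  have hv : φ (LinearMap.pi r v) = 0 := hrange (LinearMap.mem_range_self _ v)
  rw [← Finset.univ_sum_single (LinearMap.pi r v), map_sum] at hv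
  rw [LinearMap.sum_apply, LinearMap.zero_apply, ← hv]
  refine Finset.sum_congr rfl fun k _ => ?_
  rw [LinearMap.smul_apply, smul_eq_mul, mul_comm, ← smul_eq_mul, ← map_smul, ← Pi.single_smul,
    smul_eq_mul, mul_one, LinearMap.pi_apply]

namespace RootBasis

section LinearAction

variable {V ι : Type*} [AddCommGroup V] [Module ℝ V] (B : RootBasis V ι)

theorem dualAct_apply (w : V ≃ₗ[ℝ] V) (a : Module.Dual ℝ V) (v : V) :
    dualAct w a v = a (w⁻¹ v) := rfl

theorem dualAct_mul (w w' : V ≃ₗ[ℝ] V) (a : Module.Dual ℝ V) :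
    dualAct (w * w') a = dualAct w (dualAct w' a) := by
  ext v
  simp only [dualAct_apply, mul_inv_rev, LinearEquiv.mul_apply]

theorem refl_apply (i : ι) (v : V) : B.refl i v = v - B.root i v • B.coroot i :=
  Module.reflection_apply _ _

theorem refl_inv (i : ι) : (B.refl i)⁻¹ = B.refl i := Module.reflection_symm _

theorem simpleRefl_mul_self (i : ι) : B.simpleRefl i * B.simpleRefl i = 1 :=
  inv_eq_iff_mul_eq_one.1 (Subtype.ext (B.refl_inv i))

theorem coe_mul_simpleRefl (w : B.weyl) (i : ι) :
    ((w * B.simpleRefl i : B.weyl) : V ≃ₗ[ℝ] V) = w * B.refl i := rfl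

theorem dualAct_refl_self (i : ι) : dualAct (B.refl i) (B.root i) = -B.root i := by
  ext v
  rw [dualAct_apply, refl_inv, refl_apply, map_sub, map_smul, B.root_coroot_two]
  simp only [smul_eq_mul, LinearMap.neg_apply]
  ring

theorem isSphericalType_empty : B.IsSphericalType ∅ := by
  rw [IsSphericalType, Set.image_empty, Subgroup.closure_empty]
  exact Set.finite_singleton 1

theorem isSphericalType_singleton (i : ι) : B.IsSphericalType {i} := by
  rw [IsSphericalType, Set.image_singleton, ← Subgroup.zpowers_eq_closure]
  refine finite_zpowers.2 (isOfFinOrder_iff_pow_eq_one.2 ⟨2, two_pos, ?_⟩)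
  rw [pow_two, ← inv_eq_iff_mul_eq_one, B.refl_inv]

end LinearAction

section Roots

variable {V ι : Type*} [AddCommGroup V] [Module ℝ V] {B : RootBasis V ι} {a : Module.Dual ℝ V}
  {c : V}

theorem root_mem_roots (i : ι) : B.root i ∈ B.roots := ⟨1, one_mem _, i, rfl⟩

theorem dualAct_mem_roots (w : B.weyl) (ha : a ∈ B.roots) :
    dualAct (w : V ≃ₗ[ℝ] V) a ∈ B.roots := by
  obtain ⟨w', hw', i, rfl⟩ := ha
  exact ⟨w * w', mul_mem w.2 hw', i, (dualAct_mul _ _ _).symm⟩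

theorem neg_mem_roots (ha : a ∈ B.roots) : -a ∈ B.roots := by
  obtain ⟨w, hw, i, rfl⟩ := ha
  refine ⟨w * B.refl i, mul_mem hw (B.refl_mem i), i, ?_⟩
  rw [dualAct_mul, dualAct_refl_self]
  rfl

theorem exists_isRootPair (ha : a ∈ B.roots) : ∃ c, B.IsRootPair a c := by
  obtain ⟨w, hw, i, rfl⟩ := ha
  exact ⟨w (B.coroot i), w, hw, i, rfl, rfl⟩

theorem IsRootPair.apply_eq_two (h : B.IsRootPair a c) : a c = 2 := by
  obtain ⟨w, -, i, rfl, rfl⟩ := h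
  simpa [dualAct_apply] using B.root_coroot_two i

theorem IsRootPair.exists_reflection (h : B.IsRootPair a c) :
    ∃ w ∈ B.weyl, ∀ v, w v = v - a v • c := by
  obtain ⟨w, hw, i, rfl, rfl⟩ := h
  refine ⟨w * B.refl i * w⁻¹, mul_mem (mul_mem hw (B.refl_mem i)) (inv_mem hw), fun v => ?_⟩
  simp [refl_apply, dualAct_apply]

theorem ne_zero_of_mem_roots (ha : a ∈ B.roots) : a ≠ 0 := by
  rintro rfl
  obtain ⟨c, hc⟩ := exists_isRootPair ha
  simpa using hc.apply_eq_two

end Roots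

section Facets

variable {V ι : Type*} [AddCommGroup V] [Module ℝ V] (B : RootBasis V ι)

/-- The root `ε w α_j`; for fixed `ε` and `w` these roots are the equations of the walls of the
chamber `ε w C^v_f` and of its faces `ε w F^v(J)`. -/
def signedRoot (ε : ℤˣ) (w : V ≃ₗ[ℝ] V) (j : ι) : Module.Dual ℝ V := ε • dualAct w (B.root j)

theorem signedRoot_apply (ε : ℤˣ) (w : V ≃ₗ[ℝ] V) (j : ι) (v : V) :
    B.signedRoot ε w j v = B.root j (ε • w⁻¹ v) := by
  rcases Int.units_eq_one_or ε with rfl | rfl <;> simp [signedRoot, dualAct_apply]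

theorem signedRoot_neg (ε : ℤˣ) (w : V ≃ₗ[ℝ] V) (j : ι) :
    B.signedRoot (-ε) w j = -B.signedRoot ε w j := by
  simp only [signedRoot, Units.neg_smul]

theorem signedRoot_mul_apply (ε : ℤˣ) (u w : V ≃ₗ[ℝ] V) (j : ι) (v : V) :
    B.signedRoot ε (u * w) j (u v) = B.signedRoot ε w j v := by
  simp [signedRoot_apply, mul_inv_rev]

theorem signedRoot_mul_refl_self (ε : ℤˣ) (w : V ≃ₗ[ℝ] V) (i : ι) :
    B.signedRoot ε (w * B.refl i) i = -B.signedRoot ε w i := by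
  ext v
  rcases Int.units_eq_one_or ε with rfl | rfl <;>
    simp [signedRoot, dualAct_mul, dualAct_refl_self, dualAct_apply]

variable {B} in
theorem signedRoot_mem_roots (ε : ℤˣ) (w : B.weyl) (j : ι) : B.signedRoot ε w j ∈ B.roots := by
  have h := dualAct_mem_roots w (root_mem_roots j)
  rcases Int.units_eq_one_or ε with rfl | rfl
  · simpa only [signedRoot, one_smul] using h
  · simpa only [signedRoot, Units.neg_smul, one_smul] using neg_mem_roots h

theorem exists_signedRoot_apply_eq [Finite ι] (ε : ℤˣ) (w : V ≃ₗ[ℝ] V) (c : ι → ℝ) :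
    ∃ v, ∀ j, B.signedRoot ε w j v = c j := by
  obtain ⟨v, hv⟩ := exists_forall_dual_apply_eq B.linearIndependent_root c
  refine ⟨w (ε • v), fun j => ?_⟩
  rw [← hv j, signedRoot_apply]
  rcases Int.units_eq_one_or ε with rfl | rfl <;> simp

theorem signedRoot_injective (ε : ℤˣ) (w : V ≃ₗ[ℝ] V) :
    Function.Injective (B.signedRoot ε w) := by
  intro j k h
  refine B.linearIndependent_root.injective (LinearMap.ext fun v => ?_)
  have hv := DFunLike.congr_fun h (w (ε • v))
  rw [signedRoot_apply, signedRoot_apply] at hv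
  rcases Int.units_eq_one_or ε with rfl | rfl <;> simpa using hv

variable {B} {ε ε₁ ε₂ : ℤˣ} {w w₁ : V ≃ₗ[ℝ] V} {i : ι} {J : Set ι} {v v' : V}

theorem mem_facet_iff : v ∈ B.facet ε w J ↔
    (∀ j ∈ J, B.signedRoot ε w j v = 0) ∧ ∀ j ∉ J, 0 < B.signedRoot ε w j v := by
  have hmem : v ∈ B.facet ε w J ↔ ε • w⁻¹ v ∈ B.stdFacet J := by
    constructor
    · rintro ⟨x, hx, rfl⟩
      rcases Int.units_eq_one_or ε with rfl | rfl <;> simpa using hx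
    · refine fun h => ⟨_, h, ?_⟩
      rcases Int.units_eq_one_or ε with rfl | rfl <;> simp
  rw [hmem]
  simp only [signedRoot_apply]
  rfl

theorem mem_facet_univ_iff : v ∈ B.facet ε w Set.univ ↔ ∀ j, B.signedRoot ε w j v = 0 := by
  simp [mem_facet_iff]

theorem mem_chamber_iff : v ∈ B.chamber ε w ↔ ∀ j, 0 < B.signedRoot ε w j v := by
  simp [chamber, mem_facet_iff]

theorem smul_mem_facet (hv : v ∈ B.facet ε w J) {t : ℝ} (ht : 0 < t) :
    t • v ∈ B.facet ε w J := by
  rw [mem_facet_iff] at hv ⊢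
  simp only [map_smul, smul_eq_mul]
  exact ⟨fun j hj => by rw [hv.1 j hj, mul_zero], fun j hj => mul_pos ht (hv.2 j hj)⟩

theorem add_mem_facet (hv : v ∈ B.facet ε w J) (hv' : v' ∈ B.facet ε w J) :
    v + v' ∈ B.facet ε w J := by
  rw [mem_facet_iff] at hv hv' ⊢
  simp only [map_add]
  exact ⟨fun j hj => by rw [hv.1 j hj, hv'.1 j hj, add_zero],
    fun j hj => add_pos (hv.2 j hj) (hv'.2 j hj)⟩

theorem nonempty_facet [Finite ι] (B : RootBasis V ι) (ε : ℤˣ) (w : V ≃ₗ[ℝ] V) (J : Set ι) :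
    (B.facet ε w J).Nonempty := by
  classical
  obtain ⟨v, hv⟩ := B.exists_signedRoot_apply_eq ε w fun j => if j ∈ J then 0 else 1
  exact ⟨v, mem_facet_iff.2 ⟨fun j hj => by rw [hv, if_pos hj],
    fun j hj => by rw [hv, if_neg hj]; exact one_pos⟩⟩

theorem facet_mul (u : V ≃ₗ[ℝ] V) : B.facet ε (u * w) J = u '' B.facet ε w J := by
  have hu : ∀ x : V, u (ε • x) = ε • u x := fun x => by
    rcases Int.units_eq_one_or ε with rfl | rfl <;> simp
  simp only [facet, Set.image_image, hu, LinearEquiv.mul_apply]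

theorem facet_mul_refl (B : RootBasis V ι) (ε : ℤˣ) (w : V ≃ₗ[ℝ] V) (i : ι) :
    B.facet ε (w * B.refl i) {i} = B.facet ε w {i} := by
  refine Set.image_congr fun v hv => ?_
  rw [LinearEquiv.mul_apply, refl_apply, hv.1 i rfl, zero_smul, sub_zero]

/-- The chamber `ε₁ w₁ C^v_f` lies on the same side of the wall `Ker (w α_i)` as the chamber
`ε₂ w C^v_f`, which has a panel in this wall. -/
def SameSide (B : RootBasis V ι) (ε₁ : ℤˣ) (w₁ : V ≃ₗ[ℝ] V) (ε₂ : ℤˣ) (w : V ≃ₗ[ℝ] V)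
    (i : ι) : Prop :=
  ∀ v ∈ B.chamber ε₁ w₁, 0 < B.signedRoot ε₂ w i v

theorem SameSide.mul_left (h : B.SameSide ε₁ w₁ ε₂ w i) (u : V ≃ₗ[ℝ] V) :
    B.SameSide ε₁ (u * w₁) ε₂ (u * w) i := by
  intro v hv
  rw [chamber, facet_mul] at hv
  obtain ⟨x, hx, rfl⟩ := hv
  rw [signedRoot_mul_apply]
  exact h x hx

end Facets

end RootBasis

namespace VectorialWeylData

open RootBasis

variable {V ι : Type*} [AddCommGroup V] [Module ℝ V] [Fintype ι] (D : VectorialWeylData V ι)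

section PositiveRoots

variable {D} {a : Module.Dual ℝ V} {v : V}

theorem neg_mem_posRoots_of_notMem (ha : a ∈ D.roots) (h : a ∉ D.posRoots) : -a ∈ D.posRoots := by
  rw [D.roots_eq] at ha
  exact ha.resolve_left h

theorem nonneg_of_mem_posCone (ha : a ∈ D.posCone) (hv : ∀ j, 0 ≤ D.root j v) : 0 ≤ a v := by
  obtain ⟨c, hc, rfl⟩ := ha
  simp only [LinearMap.sum_apply, LinearMap.smul_apply, smul_eq_mul]
  exact Finset.sum_nonneg fun k _ => mul_nonneg (hc k) (hv k)

theorem pos_of_mem_posCone (ha : a ∈ D.posCone) (ha₀ : a ≠ 0) (hv : ∀ j, 0 < D.root j v) :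
    0 < a v := by
  obtain ⟨c, hc, rfl⟩ := ha
  obtain ⟨j, -, hj⟩ := Finset.exists_ne_zero_of_sum_ne_zero ha₀
  have hcj : 0 < c j := (hc j).lt_of_ne fun h => hj (by rw [← h, zero_smul])
  simp only [LinearMap.sum_apply, LinearMap.smul_apply, smul_eq_mul]
  exact Finset.sum_pos' (fun k _ => mul_nonneg (hc k) (hv k).le)
    ⟨j, Finset.mem_univ _, mul_pos hcj (hv j)⟩

theorem mem_posRoots_of_pos (ha : a ∈ D.roots) (hv : ∀ j, 0 ≤ D.root j v) (hav : 0 < a v) :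
    a ∈ D.posRoots := by
  by_contra h
  have := nonneg_of_mem_posCone (neg_mem_posRoots_of_notMem ha h).2 hv
  rw [LinearMap.neg_apply] at this
  linarith

theorem mem_posRoots_iff_forall_pos (ha : a ∈ D.roots) :
    a ∈ D.posRoots ↔ ∀ v, (∀ j, 0 < D.root j v) → 0 < a v := by
  refine ⟨fun h v hv => pos_of_mem_posCone h.2 (ne_zero_of_mem_roots ha) hv, fun h => ?_⟩
  obtain ⟨v, hv⟩ := exists_forall_dual_apply_eq D.linearIndependent_root 1
  have hpos : ∀ j, 0 < D.root j v := fun j => by rw [hv]; exact one_pos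
  exact mem_posRoots_of_pos ha (fun j => (hpos j).le) (h v hpos)

theorem neg_mem_posRoots_iff (ha : a ∈ D.roots) : -a ∈ D.posRoots ↔ a ∉ D.posRoots :=
  ⟨fun h h' => Set.disjoint_left.1 D.disjoint_roots h' h, neg_mem_posRoots_of_notMem ha⟩

theorem eq_one_of_forall_mem_posRoots {u : D.weyl}
    (h : ∀ j, dualAct (u : V ≃ₗ[ℝ] V) (D.root j) ∈ D.posRoots) : u = 1 := by
  by_contra hu
  obtain ⟨j, hj⟩ := D.cs.exists_rightDescent_of_ne_one hu
  rw [CoxeterSystem.IsRightDescent, D.cs_simple] at hj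
  exact lt_asymm ((D.pos_iff_length u j).1 (h j)) hj

end PositiveRoots

section Chambers

variable {D} {ε ε₁ ε₂ : ℤˣ} {w w' w₁ : D.weyl} {i : ι} {J : Set ι} {v : V}

theorem eq_of_mem_facet (hv : v ∈ D.facet ε w J) (hv' : ∀ j, 0 ≤ D.signedRoot ε w' j v)
    (hJ : ∀ j ∈ J, dualAct ((w'⁻¹ * w : D.weyl) : V ≃ₗ[ℝ] V) (D.root j) ∈ D.posRoots) :
    w' = w := by
  refine inv_mul_eq_one.1 (eq_one_of_forall_mem_posRoots fun j => ?_)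
  by_cases hj : j ∈ J
  · exact hJ j hj
  refine mem_posRoots_of_pos (dualAct_mem_roots _ (root_mem_roots j))
    (v := ε • (w' : V ≃ₗ[ℝ] V)⁻¹ v) (fun k => ?_) ?_
  · rw [← signedRoot_apply]
    exact hv' k
  · convert (mem_facet_iff.1 hv).2 j hj using 1
    rw [signedRoot_apply, dualAct_apply]
    rcases Int.units_eq_one_or ε with rfl | rfl <;> simp

theorem eq_of_mem_chamber (hv : v ∈ D.chamber ε w) (hv' : v ∈ D.chamber ε w') : w' = w :=
  eq_of_mem_facet hv (fun j => (mem_chamber_iff.1 hv' j).le) fun _ h => h.elim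

theorem facet_mul_simpleRefl (ε : ℤˣ) (w : D.weyl) (i : ι) :
    D.facet ε (w * D.simpleRefl i : D.weyl) {i} = D.facet ε w {i} :=
  D.facet_mul_refl ε w i

theorem eq_or_eq_mul_simpleRefl_of_facet_eq (h : D.facet ε w {i} = D.facet ε w' {i}) :
    w' = w ∨ w' = w * D.simpleRefl i := by
  obtain ⟨v, hv⟩ := D.nonempty_facet ε w {i}
  have hv' : ∀ j, 0 ≤ D.signedRoot ε w' j v := fun j => by
    rw [h, mem_facet_iff] at hv
    by_cases hj : j ∈ ({i} : Set ι)
    exacts [(hv.1 j hj).ge, (hv.2 j hj).le]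
  have hroot := dualAct_mem_roots (w'⁻¹ * w) (root_mem_roots (B := D.toRootBasis) i)
  by_cases hpos : dualAct ((w'⁻¹ * w : D.weyl) : V ≃ₗ[ℝ] V) (D.root i) ∈ D.posRoots
  · exact Or.inl (eq_of_mem_facet hv hv' fun j hj => hj ▸ hpos)
  · refine Or.inr (eq_of_mem_facet (J := {i}) ?_ hv' fun j hj => ?_)
    · rwa [facet_mul_simpleRefl]
    · rw [hj, ← mul_assoc, coe_mul_simpleRefl, dualAct_mul, dualAct_refl_self]
      exact neg_mem_posRoots_of_notMem hroot hpos

theorem sameSide_iff_length_lt : D.SameSide ε₁ w₁ ε₂ w i ↔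
    (D.cs.length (w₁⁻¹ * w) < D.cs.length (w₁⁻¹ * w * D.simpleRefl i) ↔ ε₁ = ε₂) := by
  have hroot := dualAct_mem_roots (w₁⁻¹ * w) (root_mem_roots (B := D.toRootBasis) i)
  set a := dualAct ((w₁⁻¹ * w : D.weyl) : V ≃ₗ[ℝ] V) (D.root i) with ha
  have hside : D.SameSide ε₁ w₁ ε₂ w i ↔ ∀ v, (∀ j, 0 < D.root j v) → 0 < (ε₂ * ε₁) • a v := by
    have hval : ∀ v, D.signedRoot ε₂ w i (ε₁ • (w₁ : V ≃ₗ[ℝ] V) v) = (ε₂ * ε₁) • a v := fun v => by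
      rw [ha, signedRoot_apply, dualAct_apply]
      rcases Int.units_eq_one_or ε₁ with rfl | rfl <;>
        rcases Int.units_eq_one_or ε₂ with rfl | rfl <;> simp
    simp only [SameSide, chamber, facet, Set.forall_mem_image, hval]
    simp [stdFacet]
  rw [hside, ← D.pos_iff_length, ← ha]
  by_cases hε : ε₁ = ε₂
  · subst hε
    simpa using (mem_posRoots_iff_forall_pos hroot).symm
  · obtain rfl : ε₂ = -ε₁ := by
      rcases Int.units_eq_one_or ε₁ with rfl | rfl <;>
        rcases Int.units_eq_one_or ε₂ with rfl | rfl <;> simp_all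
    simpa [hε, neg_mem_posRoots_iff hroot] using
      (mem_posRoots_iff_forall_pos (neg_mem_roots hroot)).symm

theorem length_mul_simpleRefl_lt_iff (u : D.weyl) (i : ι) :
    D.cs.length (u * D.simpleRefl i) < D.cs.length u ↔
      ¬ D.cs.length u < D.cs.length (u * D.simpleRefl i) := by
  rw [← D.cs_simple, not_lt, (D.cs.length_mul_simple_ne u i).le_iff_lt]

theorem sameSide_mul_simpleRefl_iff :
    D.SameSide ε₁ w₁ ε₂ (w * D.simpleRefl i : D.weyl) i ↔ ¬ D.SameSide ε₁ w₁ ε₂ w i := by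
  simp only [sameSide_iff_length_lt, ← mul_assoc]
  rw [mul_assoc _ (D.simpleRefl i), D.simpleRefl_mul_self, mul_one,
    length_mul_simpleRefl_lt_iff]
  tauto

theorem exists_sameSide (ε₁ ε₂ : ℤˣ) (w₁ w₂ : D.weyl) (i : ι) :
    ∃ w : D.weyl, D.facet ε₂ w {i} = D.facet ε₂ w₂ {i} ∧ D.SameSide ε₁ w₁ ε₂ w i := by
  by_cases h : D.SameSide ε₁ w₁ ε₂ w₂ i
  · exact ⟨w₂, rfl, h⟩
  · exact ⟨w₂ * D.simpleRefl i, facet_mul_simpleRefl _ _ _, sameSide_mul_simpleRefl_iff.2 h⟩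

theorem eq_of_sameSide (h : D.SameSide ε₁ w₁ ε₂ w i) (h' : D.SameSide ε₁ w₁ ε₂ w' i)
    (hfacet : D.facet ε₂ w {i} = D.facet ε₂ w' {i}) : w' = w := by
  refine (eq_or_eq_mul_simpleRefl_of_facet_eq hfacet).resolve_right ?_
  rintro rfl
  exact sameSide_mul_simpleRefl_iff.1 h' h

theorem simpleRefl_ne_one (i : ι) : D.simpleRefl i ≠ 1 := by
  intro h
  have := D.cs.length_simple i
  rw [D.cs_simple, h, CoxeterSystem.length_one] at this
  exact zero_ne_one this

end Chambers

end VectorialWeylData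

section RealAnalysis

theorem not_bddAbove_of_forall_two_mul_sub_mem {S : Set ℝ} (hS : S.Nontrivial)
    (hrefl : ∀ k ∈ S, ∀ l ∈ S, 2 * k - l ∈ S) : ¬BddAbove S := by
  intro hbdd
  obtain ⟨k, hk, l, hl, hkl⟩ := hS.exists_lt
  obtain ⟨x, hx, hlt⟩ := exists_lt_of_lt_csSup hS.nonempty
    (show sSup S - 2 * (l - k) < sSup S by linarith)
  have := le_csSup hbdd (hrefl l hl _ (hrefl k hk x hx))
  linarith

theorem nonneg_of_forall_nonneg_add_mul {x y : ℝ} (h : ∀ t > 0, 0 ≤ x + t * y) : 0 ≤ y := by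
  by_contra! hy
  have := h ((|x| + 1) / -y) (div_pos (by positivity) (neg_pos.2 hy))
  rw [div_mul_eq_mul_div, mul_div_assoc, div_neg, div_self hy.ne] at this
  linarith [le_abs_self x]

variable {E : Type*} [AddCommGroup E] [Module ℝ E] [TopologicalSpace E] [IsTopologicalAddGroup E]
  [ContinuousSMul ℝ E]

theorem tendsto_add_smul_nhdsGT_zero (v u : E) :
    Tendsto (fun s : ℝ => v + s • u) (𝓝[>] 0) (𝓝 v) := by
  have h : Continuous fun s : ℝ => v + s • u := by fun_prop
  simpa using (h.tendsto 0).mono_left nhdsWithin_le_nhds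

theorem closure_iInter₂_of_convex {κ : Type*} {s : Set κ} {h : κ → Set E}
    (hconv : ∀ a ∈ s, Convex ℝ (h a)) (hoc : ∀ a ∈ s, IsOpen (h a) ∨ IsClosed (h a))
    (hne : (⋂ a ∈ s, h a).Nonempty) : closure (⋂ a ∈ s, h a) = ⋂ a ∈ s, closure (h a) := by
  refine Set.Subset.antisymm (closure_minimal (Set.iInter₂_mono fun a _ => subset_closure)
    (isClosed_biInter fun a _ => isClosed_closure)) fun v hv => ?_
  obtain ⟨o, ho⟩ := hne
  rw [Set.mem_iInter₂] at hv ho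
  have hseg : openSegment ℝ o v ⊆ ⋂ a ∈ s, h a := by
    refine Set.subset_iInter₂ fun a ha => ?_
    rcases hoc a ha with hopen | hclosed
    · have := (hconv a ha).openSegment_interior_closure_subset_interior (x := o) (y := v)
      rw [hopen.interior_eq] at this
      exact this (ho a ha) (hv a ha)
    · exact (hconv a ha).openSegment_subset (ho a ha) (hclosed.closure_eq ▸ hv a ha)
  exact closure_mono hseg
    (segment_subset_closure_openSegment (x := o) (y := v) (right_mem_segment ℝ o v))

end RealAnalysis

namespace RootBasis

section Topology

variable {V ι : Type*} [NormedAddCommGroup V] [NormedSpace ℝ V] [FiniteDimensional ℝ V]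
  {B : RootBasis V ι} {ε : ℤˣ} {w : V ≃ₗ[ℝ] V} {J : Set ι} {v v' : V}

theorem continuous_signedRoot (B : RootBasis V ι) (ε : ℤˣ) (w : V ≃ₗ[ℝ] V) (j : ι) :
    Continuous (B.signedRoot ε w j) :=
  LinearMap.continuous_of_finiteDimensional _

variable [Finite ι]

theorem isOpen_chamber (B : RootBasis V ι) (ε : ℤˣ) (w : V ≃ₗ[ℝ] V) :
    IsOpen (B.chamber ε w) := by
  have h : B.chamber ε w = ⋂ j, {v | 0 < B.signedRoot ε w j v} := by
    ext v
    simp [mem_chamber_iff]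
  rw [h]
  exact isOpen_iInter_of_finite fun j =>
    isOpen_lt continuous_const (B.continuous_signedRoot ε w j)

theorem mem_closure_facet_iff : v ∈ closure (B.facet ε w J) ↔
    (∀ j ∈ J, B.signedRoot ε w j v = 0) ∧ ∀ j, 0 ≤ B.signedRoot ε w j v := by
  constructor
  · refine fun hv => ⟨fun j hj => ?_, fun j => ?_⟩
    · exact closure_minimal (fun u hu => (mem_facet_iff.1 hu).1 j hj)
        (isClosed_eq (B.continuous_signedRoot ε w j) continuous_const) hv
    · refine closure_minimal (t := {u | 0 ≤ B.signedRoot ε w j u}) (fun u hu => ?_)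
        (isClosed_le continuous_const (B.continuous_signedRoot ε w j)) hv
      by_cases hj : j ∈ J
      exacts [((mem_facet_iff.1 hu).1 j hj).ge, ((mem_facet_iff.1 hu).2 j hj).le]
  · rintro ⟨hzero, hnonneg⟩
    obtain ⟨u, hu⟩ := B.nonempty_facet ε w J
    refine mem_closure_of_tendsto (tendsto_add_smul_nhdsGT_zero v u) ?_
    filter_upwards [self_mem_nhdsWithin] with s hs
    have hsu := mem_facet_iff.1 (smul_mem_facet hu hs)
    simp only [mem_facet_iff, map_add]
    exact ⟨fun j hj => by rw [hzero j hj, hsu.1 j hj, add_zero],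
      fun j hj => add_pos_of_nonneg_of_pos (hnonneg j) (hsu.2 j hj)⟩

theorem mem_closure_chamber_iff :
    v ∈ closure (B.chamber ε w) ↔ ∀ j, 0 ≤ B.signedRoot ε w j v := by
  simp [chamber, mem_closure_facet_iff]

theorem zero_mem_closure_facet : (0 : V) ∈ closure (B.facet ε w J) := by
  simp [mem_closure_facet_iff]

theorem add_mem_closure_facet (hv : v ∈ closure (B.facet ε w J))
    (hv' : v' ∈ closure (B.facet ε w J)) : v + v' ∈ closure (B.facet ε w J) := by
  rw [mem_closure_facet_iff] at *
  simp only [map_add]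
  exact ⟨fun j hj => by rw [hv.1 j hj, hv'.1 j hj, add_zero],
    fun j => add_nonneg (hv.2 j) (hv'.2 j)⟩

theorem closure_add_mem_facet (hv : v ∈ closure (B.facet ε w J)) (hv' : v' ∈ B.facet ε w J) :
    v + v' ∈ B.facet ε w J := by
  rw [mem_closure_facet_iff] at hv
  rw [mem_facet_iff] at *
  simp only [map_add]
  exact ⟨fun j hj => by rw [hv.1 j hj, hv'.1 j hj, add_zero],
    fun j hj => add_pos_of_nonneg_of_pos (hv.2 j) (hv'.2 j hj)⟩

theorem facet_univ_subset_closure_chamber (ε' : ℤˣ) :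
    B.facet ε' w Set.univ ⊆ closure (B.chamber ε w) := by
  intro v hv
  rw [mem_facet_univ_iff] at hv
  refine mem_closure_chamber_iff.2 fun j => Eq.ge ?_
  rcases Int.units_eq_one_or ε with rfl | rfl <;> rcases Int.units_eq_one_or ε' with rfl | rfl <;>
    simpa [signedRoot_neg] using hv j

theorem mem_closure_add_facet (x : V) : x ∈ closure ((fun v => x + v) '' B.facet ε w J) := by
  exact image_closure_subset_closure_image (continuous_const_add x)
    ⟨0, zero_mem_closure_facet, add_zero x⟩

end Topology

end RootBasis

namespace AffineApartment

open RootBasis VectorialWeylData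

section Walls

variable {V ι : Type*} [NormedAddCommGroup V] [NormedSpace ℝ V] [Fintype ι]
  {D : VectorialWeylData V ι} (𝔸 : AffineApartment D) {a : Module.Dual ℝ V}

theorem exists_affWeyl_reflection {c : V} (h : D.IsRootPair a c) {k : ℝ}
    (hk : affineHyperplane a k ∈ 𝔸.walls) : ∃ g ∈ 𝔸.affWeyl, ∀ v, g v = v - (a v + k) • c := by
  let g : V ≃ᵃ[ℝ] V := (Module.reflection h.apply_eq_two).toAffineEquiv.trans
    (AffineEquiv.constVAdd ℝ V (-(k • c)))
  have hg : ∀ v, g v = v - (a v + k) • c := fun v => by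
    simp [g, Module.reflection_apply, add_smul]
    abel
  exact ⟨g, Subgroup.subset_closure ⟨a, c, k, h, hk, hg⟩, hg⟩

theorem two_mul_sub_mem_walls (ha : a ∈ D.roots) {k l : ℝ} (hk : affineHyperplane a k ∈ 𝔸.walls)
    (hl : affineHyperplane a l ∈ 𝔸.walls) : affineHyperplane a (2 * k - l) ∈ 𝔸.walls := by
  obtain ⟨c, hc⟩ := exists_isRootPair ha
  obtain ⟨g, hg, hgv⟩ := 𝔸.exists_affWeyl_reflection hc hk
  have hag : ∀ v, a (g v) = -a v - 2 * k := fun v => by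
    rw [hgv, map_sub, map_smul, hc.apply_eq_two, smul_eq_mul]
    ring
  have hinv : Function.Involutive g := fun v => by
    rw [hgv (g v), hag, hgv v]
    module
  convert 𝔸.walls_stable g hg _ hl using 1
  rw [Set.image_eq_preimage_of_inverse hinv.leftInverse hinv.rightInverse]
  ext v
  simp only [affineHyperplane, Set.mem_preimage, Set.mem_ofPred_eq, hag]
  constructor <;> intro h <;> linarith

theorem exists_level_gt (ha : a ∈ D.roots) (t : ℝ) : ∃ k ∈ 𝔸.levels a, t < k := by
  obtain ⟨k, hk, htk⟩ := not_bddAbove_iff.1 (not_bddAbove_of_forall_two_mul_sub_mem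
    (𝔸.walls_infinite a ha).nontrivial fun k hk l hl => 𝔸.two_mul_sub_mem_walls ha hk hl) t
  exact ⟨k, Or.inr hk, htk⟩

theorem exists_level_lt (ha : a ∈ D.roots) (t : ℝ) : ∃ k ∈ 𝔸.levels a, k < t := by
  obtain ⟨k, hk, htk⟩ := 𝔸.exists_level_gt (neg_mem_roots ha) (-t)
  refine ⟨-k, hk.imp (fun h => neg_neg a ▸ 𝔸.imRoots_neg _ h) fun h => ?_, neg_lt.1 htk⟩
  convert h using 1
  ext v
  simp only [affineHyperplane, Set.mem_ofPred_eq, LinearMap.neg_apply]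
  constructor <;> intro h <;> linarith

theorem linear_mem_weyl {g : V ≃ᵃ[ℝ] V} (hg : g ∈ 𝔸.affWeyl) : g.linear ∈ D.weyl := by
  suffices h : 𝔸.affWeyl ≤ D.weyl.comap AffineEquiv.linearHom from h hg
  rw [affWeyl, Subgroup.closure_le]
  rintro g ⟨a, c, k, hac, -, hg⟩
  obtain ⟨w, hw, hwv⟩ := hac.exists_reflection
  have hlin : g.linear = w := by
    ext v
    have h : g v = g.linear v + g 0 := by simpa using g.map_vadd 0 v
    rw [eq_sub_of_add_eq h.symm, hg, hg, hwv, map_zero]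
    module
  change g.linear ∈ D.weyl
  rwa [hlin]

theorem exists_coeff_signedRoot (ha : a ∈ 𝔸.allRoots) (ε : ℤˣ) (w : D.weyl) :
    ∃ d : ι → ℝ, (0 ≤ d ∨ d ≤ 0) ∧ a = ∑ j, d j • D.signedRoot ε w j := by
  have hcone : dualAct ((w⁻¹ : D.weyl) : V ≃ₗ[ℝ] V) a ∈ D.posCone ∨
      -dualAct ((w⁻¹ : D.weyl) : V ≃ₗ[ℝ] V) a ∈ D.posCone := by
    rcases ha with ha | ha
    · have := dualAct_mem_roots w⁻¹ ha
      rw [D.roots_eq] at this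
      exact this.imp And.right And.right
    · exact 𝔸.imRoots_subset _ (𝔸.imRoots_weyl _ (w⁻¹).2 _ ha)
  obtain ⟨d, hd, hsum⟩ : ∃ d : ι → ℝ, (0 ≤ d ∨ d ≤ 0) ∧
      dualAct ((w⁻¹ : D.weyl) : V ≃ₗ[ℝ] V) a = ∑ j, d j • D.root j := by
    rcases hcone with ⟨c, hc, h⟩ | ⟨c, hc, h⟩
    · exact ⟨c, Or.inl hc, h⟩
    · refine ⟨-c, Or.inr (neg_nonpos.2 hc), LinearMap.ext fun v => ?_⟩
      simpa [neg_eq_iff_eq_neg] using DFunLike.congr_fun h v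
  have hav : ∀ v, a v = ∑ j, d j * D.root j ((w : V ≃ₗ[ℝ] V)⁻¹ v) := fun v => by
    simpa [dualAct_apply] using DFunLike.congr_fun hsum ((w : V ≃ₗ[ℝ] V)⁻¹ v)
  rcases Int.units_eq_one_or ε with rfl | rfl
  · exact ⟨d, hd, LinearMap.ext fun v => by simp [hav, signedRoot_apply]⟩
  · exact ⟨-d, by simpa [or_comm] using hd,
      LinearMap.ext fun v => by simp [hav, signedRoot_apply]⟩

theorem nonneg_on_chamber_of_nonneg_on_panel (ha : a ∈ 𝔸.allRoots) {ε : ℤˣ} {w : D.weyl} {i : ι}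
    {v y z : V} (hz : z ∈ D.facet ε w {i}) (haz : 0 ≤ a z) (hy : 0 < D.signedRoot ε w i y)
    (hay : 0 ≤ a y) (hv : v ∈ D.chamber ε w) : 0 ≤ a v := by
  obtain ⟨d, hd, rfl⟩ := 𝔸.exists_coeff_signedRoot ha ε w
  simp only [LinearMap.sum_apply, LinearMap.smul_apply, smul_eq_mul] at *
  -- If `d ≤ 0`, then `0 ≤ a z` forces `d j = 0` for `j ≠ i`, and `0 ≤ a y` forces `0 ≤ d i`.
  suffices hd0 : ∀ j, 0 ≤ d j from
    Finset.sum_nonneg fun j _ => mul_nonneg (hd0 j) (mem_chamber_iff.1 hv j).le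
  refine hd.elim id fun hd => ?_
  have hz := mem_facet_iff.1 hz
  have hterm : ∀ j ∈ Finset.univ, d j * D.signedRoot ε w j z ≤ 0 := fun j _ => by
    by_cases hj : j ∈ ({i} : Set ι)
    · rw [hz.1 j hj, mul_zero]
    · exact mul_nonpos_of_nonpos_of_nonneg (hd j) (hz.2 j hj).le
  have hd_ne : ∀ j ≠ i, d j = 0 := fun j hj => (mul_eq_zero.1 ((Finset.sum_eq_zero_iff_of_nonpos
    hterm).1 (le_antisymm (Finset.sum_nonpos hterm) haz) j (Finset.mem_univ j))).resolve_right
      (hz.2 j hj).ne'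
  rw [Finset.sum_eq_single i (fun j _ hj => by rw [hd_ne j hj, zero_mul])
    fun h => absurd (Finset.mem_univ i) h] at hay
  intro j
  by_cases hj : j = i
  exacts [hj ▸ nonneg_of_mul_nonneg_left hay hy, (hd_ne j hj).ge]

end Walls

end AffineApartment

namespace RootBasis

section ClosedSectors

variable {V ι : Type*} [AddCommGroup V] [Module ℝ V] (B : RootBasis V ι) (ε : ℤˣ) (w : V ≃ₗ[ℝ] V)

/-- The translated closed chamber `⋂_j D(ε w α_j, k_j)`. -/
def closedSector (k : ι → ℝ) : Set V := {v | ∀ j, 0 ≤ B.signedRoot ε w j v + k j}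

end ClosedSectors

section ClosedSectorTopology

variable {V ι : Type*} [NormedAddCommGroup V] [NormedSpace ℝ V] [FiniteDimensional ℝ V] [Finite ι]

theorem closedSector_mem_nhds {B : RootBasis V ι} {ε : ℤˣ} {w : V ≃ₗ[ℝ] V} {k : ι → ℝ} {x : V}
    (hx : ∀ j, 0 < B.signedRoot ε w j x + k j) : B.closedSector ε w k ∈ 𝓝 x := by
  have hev : ∀ᶠ v in 𝓝 x, ∀ j, 0 < B.signedRoot ε w j v + k j := eventually_all.2 fun j =>
    ((B.continuous_signedRoot ε w j).add continuous_const).continuousAt.eventually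
      (lt_mem_nhds (hx j))
  exact hev.mono fun v hv j => (hv j).le

end ClosedSectorTopology

end RootBasis

namespace AffineApartment

open RootBasis VectorialWeylData

section HalfSpaces

variable {V ι : Type*} [NormedAddCommGroup V] [NormedSpace ℝ V] [Fintype ι]
  {D : VectorialWeylData V ι} {𝔸 : AffineApartment D} {a : Module.Dual ℝ V} {K : Set V}

theorem convex_of_mem_halves (hK : K ∈ 𝔸.halves a) : Convex ℝ K := by
  rcases hK with (rfl | ⟨k, -, rfl⟩) | ⟨k, -, rfl⟩
  · exact convex_univ
  · simpa only [neg_le_iff_add_nonneg] using convex_halfSpace_ge a.isLinear (-k)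
  · simpa only [neg_lt_iff_pos_add] using convex_halfSpace_gt a.isLinear (-k)

variable [FiniteDimensional ℝ V]

theorem isClosed_of_mem_closedHalves (hK : K ∈ 𝔸.closedHalves a) : IsClosed K := by
  rcases hK with rfl | ⟨k, -, rfl⟩
  · exact isClosed_univ
  · exact isClosed_le continuous_const (a.continuous_of_finiteDimensional.add continuous_const)

theorem isOpen_or_isClosed_of_mem_halves (hK : K ∈ 𝔸.halves a) : IsOpen K ∨ IsClosed K := by
  rcases hK with hK | ⟨k, -, rfl⟩
  · exact Or.inr (isClosed_of_mem_closedHalves hK)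
  · exact Or.inl
      (isOpen_lt continuous_const (a.continuous_of_finiteDimensional.add continuous_const))

theorem closure_mem_closedHalves (hK : K ∈ 𝔸.halves a) (hne : K.Nonempty) :
    closure K ∈ 𝔸.closedHalves a := by
  rcases hK with hK | ⟨k, hk, rfl⟩
  · rwa [(isClosed_of_mem_closedHalves hK).closure_eq]
  refine Or.inr ⟨k, hk, Set.Subset.antisymm (closure_minimal (fun v hv => hv.out.le)
    (isClosed_of_mem_closedHalves (𝔸 := 𝔸) (Or.inr ⟨k, hk, rfl⟩))) fun v hv => ?_⟩
  obtain ⟨o, ho⟩ := hne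
  refine closure_mono ?_
    (segment_subset_closure_openSegment (x := o) (y := v) (right_mem_segment ℝ o v))
  rintro _ ⟨s, t, hs, ht, hst, rfl⟩
  have h : a (s • o + t • v) + k = s * (a o + k) + t * (a v + k) := by
    simp only [map_add, map_smul, smul_eq_mul]
    linear_combination -k * hst
  change 0 < a (s • o + t • v) + k
  rw [h]
  exact add_pos_of_pos_of_nonneg (mul_pos hs ho) (mul_nonneg ht.le hv)

end HalfSpaces

section Enclosure

variable {V ι : Type*} [NormedAddCommGroup V] [NormedSpace ℝ V] [Fintype ι]
  {D : VectorialWeylData V ι} (𝔸 : AffineApartment D)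

/-- An enclosed subset of the apartment, of the form `⋂_{α ∈ Δ} D(α, k_α)`; the enclosure of a
filter is generated by the enclosed subsets belonging to it. -/
def IsEnclosed (T : Set V) : Prop :=
  ∃ c : Module.Dual ℝ V → Set V, (∀ a ∈ 𝔸.allRoots, c a ∈ 𝔸.closedHalves a) ∧
    T = ⋂ a ∈ 𝔸.allRoots, c a

variable {𝔸}

theorem mem_cl_iff {F : Filter V} {S : Set V} :
    S ∈ 𝔸.cl F ↔ ∃ T, 𝔸.IsEnclosed T ∧ T ∈ F ∧ T ⊆ S := by
  constructor
  · rintro ⟨c, hc, hF, hS⟩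
    exact ⟨_, ⟨c, hc, rfl⟩, hF, hS⟩
  · rintro ⟨_, ⟨c, hc, rfl⟩, hF, hS⟩
    exact ⟨c, hc, hF, hS⟩

theorem le_cl (F : Filter V) : F ≤ 𝔸.cl F := by
  intro S hS
  obtain ⟨T, -, hT, hTS⟩ := mem_cl_iff.1 hS
  exact mem_of_superset hT hTS

theorem IsEnclosed.isClosed [FiniteDimensional ℝ V] {T : Set V} (hT : 𝔸.IsEnclosed T) :
    IsClosed T := by
  obtain ⟨c, hc, rfl⟩ := hT
  exact isClosed_biInter fun a ha => isClosed_of_mem_closedHalves (hc a ha)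

theorem IsEnclosed.mem_affFacet {T : Set V} (hT : 𝔸.IsEnclosed T) {x : V} (hx : T ∈ 𝓝 x)
    (F₀ : Set V) : T ∈ 𝔸.affFacet x F₀ := by
  obtain ⟨c, hc, rfl⟩ := hT
  exact ⟨c, fun a ha => Or.inl (hc a ha), mem_nhdsWithin_of_mem_nhds hx, subset_rfl⟩

theorem isEnclosed_closedSector {ε : ℤˣ} {w : D.weyl} {k : ι → ℝ}
    (hk : ∀ j, k j ∈ 𝔸.levels (D.signedRoot ε w j)) : 𝔸.IsEnclosed (D.closedSector ε w k) := by
  refine ⟨fun a => {v | ∀ j, D.signedRoot ε w j = a → 0 ≤ a v + k j}, fun a _ => ?_, ?_⟩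
  · by_cases h : ∃ j, D.signedRoot ε w j = a
    · obtain ⟨j, rfl⟩ := h
      exact Or.inr ⟨k j, hk j, Set.ext fun v =>
        ⟨fun h => h j rfl, fun h l hl => D.signedRoot_injective ε w hl ▸ h⟩⟩
    · exact Or.inl (Set.eq_univ_of_forall fun v j hj => absurd ⟨j, hj⟩ h)
  · ext v
    simp only [closedSector, Set.mem_iInter, Set.mem_ofPred_eq]
    constructor
    · rintro h a - j rfl
      exact h j
    · exact fun h j => h _ (Or.inl (signedRoot_mem_roots ε w j)) j rfl

theorem IsEnclosed.add_mem_of_sameSide {T : Set V} (hT : 𝔸.IsEnclosed T) {ε₁ ε₂ : ℤˣ}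
    {w₁ : V ≃ₗ[ℝ] V} {w : D.weyl} {i : ι} (hside : D.SameSide ε₁ w₁ ε₂ w i) {q y : V}
    (hq : ∀ v ∈ D.chamber ε₁ w₁, q + v ∈ T) (hy : ∀ v ∈ D.facet ε₂ w {i}, y + v ∈ T)
    {v v₁ : V} (hv : v ∈ D.chamber ε₂ w) (hv₁ : v₁ ∈ D.chamber ε₁ w₁) : q + v₁ + v ∈ T := by
  obtain ⟨c, hc, rfl⟩ := hT
  rw [Set.mem_iInter₂]
  intro a ha
  rcases hc a ha with h | ⟨k, -, h⟩
  · exact h ▸ Set.mem_univ _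
  have hq' : ∀ v ∈ D.chamber ε₁ w₁, 0 ≤ a q + a v + k := fun v hv => by
    have hmem := Set.mem_iInter₂.1 (hq v hv) a ha
    rwa [h, Set.mem_ofPred_eq, map_add] at hmem
  have hy' : ∀ v ∈ D.facet ε₂ w {i}, 0 ≤ a y + a v + k := fun v hv => by
    have hmem := Set.mem_iInter₂.1 (hy v hv) a ha
    rwa [h, Set.mem_ofPred_eq, map_add] at hmem
  obtain ⟨z, hz⟩ := D.nonempty_facet ε₂ w {i}
  have hav₁ : 0 ≤ a v₁ := nonneg_of_forall_nonneg_add_mul (x := a q + k) fun t ht => by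
    have := hq' _ (smul_mem_facet hv₁ ht)
    rw [map_smul, smul_eq_mul] at this
    linarith
  have haz : 0 ≤ a z := nonneg_of_forall_nonneg_add_mul (x := a y + k) fun t ht => by
    have := hy' _ (smul_mem_facet hz ht)
    rw [map_smul, smul_eq_mul] at this
    linarith
  have hav : 0 ≤ a v :=
    𝔸.nonneg_on_chamber_of_nonneg_on_panel ha hz haz (hside v₁ hv₁) hav₁ hv
  rw [h, Set.mem_ofPred_eq, map_add, map_add]
  linarith [hq' v₁ hv₁]

end Enclosure

section SectorTranslations

variable {V ι : Type*} [NormedAddCommGroup V] [NormedSpace ℝ V] [Fintype ι]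
  {D : VectorialWeylData V ι}

theorem map_sectorGerm (g : V ≃ᵃ[ℝ] V) (C : Set V) :
    map g (sectorGerm C) = sectorGerm (g.linear '' C) := by
  have hmap : map g (sectorGerm C) = comap g.symm (sectorGerm C) :=
    Filter.map_equiv_symm g.symm.toEquiv _
  rw [hmap, sectorGerm, sectorGerm, comap_iInf]
  refine g.surjective.iInf_congr _ fun x => ?_
  have hadd : ∀ v, g (x + v) = g x + g.linear v := fun v => by
    simpa [add_comm] using g.map_vadd x v
  rw [comap_principal, g.preimage_symm]
  simp only [Set.image_image, hadd]

end SectorTranslations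

section ChimneyGerms

variable {V ι : Type*} [NormedAddCommGroup V] [NormedSpace ℝ V] [Fintype ι]
  {D : VectorialWeylData V ι} {𝔸 : AffineApartment D}

theorem mem_shortChimney_iff {x ξ : V} {F₀ Fv S : Set V} :
    S ∈ 𝔸.shortChimney x F₀ Fv ξ ↔ ∃ T, 𝔸.IsEnclosed T ∧
      (∃ U ∈ 𝔸.affFacet x F₀, ∀ u ∈ U, ∀ v ∈ Fv, u + ξ + v ∈ T) ∧ T ⊆ S := by
  refine mem_cl_iff.trans
    (exists_congr fun T => and_congr_right fun _ => and_congr_left fun _ => ?_)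
  rw [mem_map₂_iff]
  constructor
  · rintro ⟨U, hU, T', hT', h⟩
    exact ⟨_, hU, fun u hu v hv => h ⟨u + ξ, hu, v, hT' hv, rfl⟩⟩
  · rintro ⟨U, hU, h⟩
    refine ⟨_, image_mem_map hU, Fv, mem_principal_self _, ?_⟩
    rintro _ ⟨_, ⟨u, hu, rfl⟩, v, hv, rfl⟩
    exact h u hu v hv

variable [FiniteDimensional ℝ V]

theorem shortChimney_add_le {B : RootBasis V ι} {ε : ℤˣ} {w : V ≃ₗ[ℝ] V} {J : Set ι}
    (x : V) (F₀ : Set V) (ξ : V) {η : V} (hη : η ∈ closure (B.facet ε w J)) :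
    𝔸.shortChimney x F₀ (B.facet ε w J) (ξ + η) ≤ 𝔸.shortChimney x F₀ (B.facet ε w J) ξ := by
  intro S hS
  obtain ⟨T, hT, ⟨U, hU, h⟩, hTS⟩ := mem_shortChimney_iff.1 hS
  refine mem_shortChimney_iff.2 ⟨T, hT, ⟨U, hU, fun u hu v hv => ?_⟩, hTS⟩
  rw [← add_assoc, add_assoc]
  exact h u hu _ (closure_add_mem_facet hη hv)

theorem mem_chimneyGerm_iff {B : RootBasis V ι} {ε : ℤˣ} {w : V ≃ₗ[ℝ] V} {J : Set ι} {x : V}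
    {F₀ S : Set V} : S ∈ 𝔸.chimneyGerm x F₀ (B.facet ε w J) ↔
      ∃ ξ ∈ closure (B.facet ε w J), ∃ T, 𝔸.IsEnclosed T ∧
        (∃ U ∈ 𝔸.affFacet x F₀, ∀ u ∈ U, ∀ v ∈ B.facet ε w J, u + ξ + v ∈ T) ∧ T ⊆ S := by
  simp only [← mem_shortChimney_iff]
  refine mem_biInf_of_directed (fun ξ hξ η hη => ?_) ⟨0, zero_mem_closure_facet⟩
  refine ⟨ξ + η, add_mem_closure_facet hξ hη, shortChimney_add_le x F₀ ξ hη, ?_⟩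
  exact add_comm η ξ ▸ shortChimney_add_le x F₀ η hξ

theorem nonempty_of_mem_affFacet {B : RootBasis V ι} {ε : ℤˣ} {w : V ≃ₗ[ℝ] V} {J : Set ι}
    {x : V} {U : Set V} (hU : U ∈ 𝔸.affFacet x (B.facet ε w J)) : U.Nonempty := by
  obtain ⟨c, -, hc, hcU⟩ := hU
  have : (localFacet x (B.facet ε w J)).NeBot :=
    mem_closure_iff_nhdsWithin_neBot.1 (mem_closure_add_facet x)
  exact (nonempty_of_mem hc).mono hcU

theorem exists_add_mem_of_mem_chimneyGerm {B : RootBasis V ι} {ε ε' : ℤˣ} {w w' : V ≃ₗ[ℝ] V}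
    {J J' : Set ι} {x : V} {S : Set V}
    (hS : S ∈ 𝔸.chimneyGerm x (B.facet ε w J) (B.facet ε' w' J')) :
    ∃ y, ∀ v ∈ B.facet ε' w' J', y + v ∈ S := by
  obtain ⟨ξ, -, T, -, ⟨U, hU, h⟩, hTS⟩ := mem_chimneyGerm_iff.1 hS
  obtain ⟨u, hu⟩ := nonempty_of_mem_affFacet hU
  exact ⟨u + ξ, fun v hv => hTS (h u hu v hv)⟩

theorem linear_apply_eq_of_eventually_chimneyGerm {B : RootBasis V ι} {ε ε' : ℤˣ}
    {w w' : V ≃ₗ[ℝ] V} {J J' : Set ι} {x : V} {g : V ≃ᵃ[ℝ] V}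
    (hg : ∀ᶠ v in 𝔸.chimneyGerm x (B.facet ε w J) (B.facet ε' w' J'), g v = v) {v : V}
    (hv : v ∈ B.facet ε' w' J') : g.linear v = v := by
  obtain ⟨y, hy⟩ := exists_add_mem_of_mem_chimneyGerm hg
  have hyv : g (y + v) = y + v := hy v hv
  have hyvv : g (y + (v + v)) = y + (v + v) := hy _ (add_mem_facet hv hv)
  have hlin : g (v +ᵥ (y + v)) = g.linear v +ᵥ g (y + v) := g.map_vadd _ _
  rw [vadd_eq_add, vadd_eq_add, hyv, add_left_comm, hyvv,
    add_left_comm] at hlin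
  exact (add_right_cancel hlin).symm

theorem closedSector_mem_chimneyGerm {ε : ℤˣ} {w : D.weyl} {J : Set ι} {k : ι → ℝ}
    (hk : ∀ j, k j ∈ 𝔸.levels (D.signedRoot ε w j)) {x : V} (F₀ : Set V)
    (hx : ∀ j ∈ J, 0 < D.signedRoot ε w j x + k j) :
    D.closedSector ε w k ∈ 𝔸.chimneyGerm x F₀ (D.facet ε w J) := by
  classical
  have hlevel : ∀ j, ∃ l ∈ 𝔸.levels (D.signedRoot ε w j), 0 < D.signedRoot ε w j x + l ∧
      (j ∈ J → l = k j) := fun j => by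
    by_cases hj : j ∈ J
    · exact ⟨k j, hk j, hx j hj, fun _ => rfl⟩
    · obtain ⟨l, hl, hlt⟩ :=
        𝔸.exists_level_gt (signedRoot_mem_roots ε w j) (-D.signedRoot ε w j x)
      exact ⟨l, hl, neg_lt_iff_pos_add'.1 hlt, fun h => absurd h hj⟩
  choose l hl hlx hlk using hlevel
  obtain ⟨ξ, hξ⟩ := D.exists_signedRoot_apply_eq ε w fun j => if j ∈ J then 0 else |l j - k j|
  have hξ_mem : ξ ∈ closure (D.facet ε w J) := mem_closure_facet_iff.2
    ⟨fun j hj => by rw [hξ, if_pos hj], fun j => by rw [hξ]; split_ifs <;> simp⟩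
  refine mem_chimneyGerm_iff.2 ⟨ξ, hξ_mem, _, isEnclosed_closedSector hk,
    ⟨D.closedSector ε w l,
      (isEnclosed_closedSector hl).mem_affFacet (closedSector_mem_nhds hlx) F₀,
      fun u hu v hv j => ?_⟩, subset_rfl⟩
  have huj : 0 ≤ D.signedRoot ε w j u + l j := hu j
  have hvj : 0 ≤ D.signedRoot ε w j v := (mem_closure_facet_iff.1 (subset_closure hv)).2 j
  rw [map_add, map_add, hξ]
  split_ifs with hj
  · rw [hlk j hj] at huj
    linarith
  · linarith [le_abs_self (l j - k j)]

theorem eventually_closure_mem_affFacet {B : RootBasis V ι} {ε : ℤˣ} {w : V ≃ₗ[ℝ] V} {p : V}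
    {U Z : Set V} (hU : U ∈ 𝔸.affFacet p (B.chamber ε w)) (hZ : Z ⊆ closure (B.chamber ε w)) :
    ∀ᶠ q in 𝓝[(fun v => p + v) '' closure (B.chamber ε w)] p, closure U ∈ 𝔸.affFacet q Z := by
  obtain ⟨c, hc, hcp, hcU⟩ := hU
  have hne : (⋂ a ∈ 𝔸.allRoots, c a).Nonempty :=
    nonempty_of_mem_affFacet (B := B) (J := ∅) ⟨c, hc, hcp, subset_rfl⟩
  have hclosure : closure (⋂ a ∈ 𝔸.allRoots, c a) = ⋂ a ∈ 𝔸.allRoots, closure (c a) :=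
    closure_iInter₂_of_convex (fun a ha => convex_of_mem_halves (hc a ha))
      (fun a ha => isOpen_or_isClosed_of_mem_halves (hc a ha)) hne
  obtain ⟨O, hO, hpO, hOc⟩ := mem_nhdsWithin.1 hcp
  filter_upwards [inter_mem_nhdsWithin _ (hO.mem_nhds hpO)]
  rintro _ ⟨⟨v, hv, rfl⟩, hqO⟩
  refine ⟨fun a => closure (c a), fun a ha => Or.inl (closure_mem_closedHalves (hc a ha)
    (hne.mono (Set.biInter_subset_of_mem ha))), ?_, hclosure ▸ closure_mono hcU⟩
  refine mem_nhdsWithin.2 ⟨O, hO, hqO, ?_⟩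
  rintro _ ⟨hzO, z, hz, rfl⟩
  rw [← hclosure]
  refine closure_mono hOc (hO.inter_closure ⟨hzO, ?_⟩)
  change p + v + z ∈ _
  rw [add_assoc]
  exact image_closure_subset_closure_image (continuous_const_add p)
    ⟨v + z, add_mem_closure_facet hv (hZ hz), rfl⟩

theorem eventually_mem_chimneyGerm {B : RootBasis V ι} {ε ε' : ℤˣ} {w w' : V ≃ₗ[ℝ] V}
    {J : Set ι} {p : V} {S Z : Set V}
    (hS : S ∈ 𝔸.chimneyGerm p (B.chamber ε w) (B.facet ε' w' J))
    (hZ : Z ⊆ closure (B.chamber ε w)) :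
    ∀ᶠ q in 𝓝[(fun v => p + v) '' closure (B.chamber ε w)] p,
      S ∈ 𝔸.chimneyGerm q Z (B.facet ε' w' J) := by
  obtain ⟨ξ, hξ, T, hT, ⟨U, hU, h⟩, hTS⟩ := mem_chimneyGerm_iff.1 hS
  filter_upwards [eventually_closure_mem_affFacet hU hZ] with q hq
  refine mem_chimneyGerm_iff.2 ⟨ξ, hξ, T, hT, ⟨closure U, hq, fun u hu v hv => ?_⟩, hTS⟩
  have hclosed : IsClosed {u | u + ξ + v ∈ T} := hT.isClosed.preimage (by fun_prop)
  exact closure_minimal (fun u hu => h u hu v hv) hclosed hu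

end ChimneyGerms

section SectorGermBasis

variable {V ι : Type*} [NormedAddCommGroup V] [NormedSpace ℝ V] [Finite ι]

theorem mem_sectorGerm_iff {B : RootBasis V ι} {ε : ℤˣ} {w : V ≃ₗ[ℝ] V} {S : Set V} :
    S ∈ sectorGerm (B.chamber ε w) ↔ ∃ x, ∀ v ∈ B.chamber ε w, x + v ∈ S := by
  have hle : ∀ {x y : V}, y - x ∈ B.chamber ε w →
      (fun v => y + v) '' B.chamber ε w ⊆ (fun v => x + v) '' B.chamber ε w := by
    rintro x y hxy _ ⟨v, hv, rfl⟩
    exact ⟨y - x + v, add_mem_facet hxy hv, by dsimp only; abel⟩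
  have hdir : Directed (· ≥ ·) fun x : V => 𝓟 ((fun v => x + v) '' B.chamber ε w) := by
    intro x y
    obtain ⟨z, hz⟩ := B.exists_signedRoot_apply_eq ε w
      fun j => max (B.signedRoot ε w j x) (B.signedRoot ε w j y) + 1
    refine ⟨z, principal_mono.2 (hle (mem_chamber_iff.2 fun j => ?_)),
      principal_mono.2 (hle (mem_chamber_iff.2 fun j => ?_))⟩ <;> rw [map_sub, hz]
    · linarith [le_max_left (B.signedRoot ε w j x) (B.signedRoot ε w j y)]
    · linarith [le_max_right (B.signedRoot ε w j x) (B.signedRoot ε w j y)]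
  simp only [sectorGerm, mem_iInf_of_directed hdir, mem_principal, Set.image_subset_iff]
  rfl

instance sectorGerm_neBot (B : RootBasis V ι) (ε : ℤˣ) (w : V ≃ₗ[ℝ] V) :
    (sectorGerm (B.chamber ε w)).NeBot := by
  refine forall_mem_nonempty_iff_neBot.1 fun S hS => ?_
  obtain ⟨x, hx⟩ := mem_sectorGerm_iff.1 hS
  obtain ⟨v, hv⟩ := B.nonempty_facet ε w ∅
  exact ⟨_, hx v hv⟩

theorem chamber_mem_sectorGerm (B : RootBasis V ι) (ε : ℤˣ) (w : V ≃ₗ[ℝ] V) :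
    B.chamber ε w ∈ sectorGerm (B.chamber ε w) :=
  mem_sectorGerm_iff.2 ⟨0, fun v hv => by rwa [zero_add]⟩

end SectorGermBasis

section SectorGerms

variable {V ι : Type*} [NormedAddCommGroup V] [NormedSpace ℝ V] [Fintype ι]
  {D : VectorialWeylData V ι} {𝔸 : AffineApartment D}

theorem sectorGerm_injective {ε : ℤˣ} {w w' : D.weyl}
    (h : sectorGerm (D.chamber ε w) = sectorGerm (D.chamber ε w')) : w' = w := by
  obtain ⟨v, hv, hv'⟩ := nonempty_of_mem (inter_mem (chamber_mem_sectorGerm D.toRootBasis ε w)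
    (h ▸ chamber_mem_sectorGerm D.toRootBasis ε w'))
  exact eq_of_mem_chamber hv hv'

theorem exists_closedSector_subset (𝔸 : AffineApartment D) {ε : ℤˣ} {w : D.weyl} {S : Set V}
    (hS : S ∈ sectorGerm (D.chamber ε w)) : ∃ k : ι → ℝ,
      (∀ j, k j ∈ 𝔸.levels (D.signedRoot ε w j)) ∧ D.closedSector ε w k ⊆ S := by
  obtain ⟨q, hq⟩ := mem_sectorGerm_iff.1 hS
  choose k hk hlt using fun j =>
    𝔸.exists_level_lt (signedRoot_mem_roots ε w j) (-D.signedRoot ε w j q)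
  refine ⟨k, hk, fun v hv => ?_⟩
  rw [← add_sub_cancel q v]
  refine hq _ (mem_chamber_iff.2 fun j => ?_)
  have hvj : 0 ≤ D.signedRoot ε w j v + k j := hv j
  rw [map_sub]
  linarith [hlt j]

variable [FiniteDimensional ℝ V]

theorem exists_mem_chimneyGerm_smul {ε : ℤˣ} {w : D.weyl} {i : ι} {S : Set V}
    (hS : S ∈ sectorGerm (D.chamber ε w)) {u : V} (hu : D.signedRoot ε w i u ≠ 0) (F₀ : Set V) :
    ∃ τ : ℝ, S ∈ 𝔸.chimneyGerm (τ • u) F₀ (D.facet ε w {i}) := by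
  obtain ⟨k, hk, hkS⟩ := exists_closedSector_subset 𝔸 hS
  refine ⟨(1 - k i) / D.signedRoot ε w i u,
    mem_of_superset (closedSector_mem_chimneyGerm hk F₀ ?_) hkS⟩
  rintro _ rfl
  rw [map_smul, smul_eq_mul, div_mul_cancel₀ _ hu, sub_add_cancel]
  exact one_pos

theorem chimneyGerm_chamber (𝔸 : AffineApartment D) (x : V) (ε ε' : ℤˣ) (w w' : D.weyl)
    (J : Set ι) :
    𝔸.chimneyGerm x (D.facet ε w J) (D.chamber ε' w') = sectorGerm (D.chamber ε' w') := by
  refine le_antisymm (fun S hS => ?_) fun S hS =>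
    mem_sectorGerm_iff.2 (exists_add_mem_of_mem_chimneyGerm hS)
  obtain ⟨k, hk, hkS⟩ := exists_closedSector_subset 𝔸 hS
  exact mem_of_superset (closedSector_mem_chimneyGerm hk _ fun _ h => h.elim) hkS

theorem sectorGerm_le_cl {p : V} {ε ε₁ ε₂ : ℤˣ} {w₀ w₁ : V ≃ₗ[ℝ] V} {w : D.weyl} {J : Set ι}
    {i : ι} (hside : D.SameSide ε₁ w₁ ε₂ w i) :
    sectorGerm (D.chamber ε₂ w) ≤
      𝔸.cl (𝔸.chimneyGerm p (D.facet ε w₀ J) (D.facet ε₂ w {i}) ⊔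
        sectorGerm (D.chamber ε₁ w₁)) := by
  intro S hS
  obtain ⟨T, hT, ⟨hTchimney, hTsector⟩, hTS⟩ := mem_cl_iff.1 hS
  obtain ⟨y, hy⟩ := exists_add_mem_of_mem_chimneyGerm hTchimney
  obtain ⟨q, hq⟩ := mem_sectorGerm_iff.1 hTsector
  obtain ⟨v₁, hv₁⟩ := D.nonempty_facet ε₁ w₁ ∅
  exact mem_sectorGerm_iff.2
    ⟨q + v₁, fun v hv => hTS (hT.add_mem_of_sameSide hside hq hy hv hv₁)⟩

end SectorGerms

section Solidity

variable {V ι : Type*} [NormedAddCommGroup V] [NormedSpace ℝ V] [Fintype ι]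
  {D : VectorialWeylData V ι} (𝔸 : AffineApartment D)

theorem chimneySolid_of_support_eq_top {x : V} {F₀ Fv : Set V}
    (h : support (𝔸.chimney x F₀ Fv) = ⊤) : 𝔸.ChimneySolid x F₀ Fv := by
  refine (Set.finite_singleton (1 : V ≃ₗ[ℝ] V)).subset ?_
  rintro g ⟨-, hg⟩
  rw [h, AffineSubspace.direction_top] at hg
  exact LinearEquiv.ext fun v => hg v Submodule.mem_top

theorem isSplayedChimneyGerm_chimneyGerm (x : V) (ε ε' : ℤˣ) (w w' : D.weyl) (J : Set ι)
    {J' : Set ι} (hJ' : D.IsSphericalType J') :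
    𝔸.IsSplayedChimneyGerm (𝔸.chimneyGerm x (D.facet ε w J) (D.facet ε' w' J')) :=
  ⟨x, _, _, ⟨ε, w, w.2, J, rfl⟩, ⟨ε', w', w'.2, J', hJ', rfl⟩, rfl⟩

variable [FiniteDimensional ℝ V]

theorem isSplayedChimneyGerm_sectorGerm (ε : ℤˣ) (w : D.weyl) :
    𝔸.IsSplayedChimneyGerm (sectorGerm (D.chamber ε w)) := by
  rw [← 𝔸.chimneyGerm_chamber 0 ε ε w w ∅]
  exact 𝔸.isSplayedChimneyGerm_chimneyGerm 0 ε ε w w ∅ D.isSphericalType_empty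

theorem support_chimney_chamber {B : RootBasis V ι} (x : V) (ε : ℤˣ) (w : V ≃ₗ[ℝ] V)
    {Fv : Set V} (hFv : Fv.Nonempty) : support (𝔸.chimney x (B.chamber ε w) Fv) = ⊤ := by
  refine eq_top_iff.2 (le_sInf fun E hE => ?_)
  obtain ⟨U, ⟨c, -, hc, hcU⟩, T, hT, hUT⟩ := mem_map₂_iff.1 (le_cl _ hE)
  obtain ⟨O, hO, hxO, hOc⟩ := mem_nhdsWithin.1 hc
  obtain ⟨v, hv⟩ := hFv
  set G := O ∩ (fun u => x + u) '' B.chamber ε w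
  have hG : IsOpen ((fun u => u + v) '' G) := (Homeomorph.addRight v).isOpenMap _
    (hO.inter ((Homeomorph.addLeft x).isOpenMap _ (B.isOpen_chamber ε w)))
  have hG_ne : G.Nonempty := mem_closure_iff.1 (mem_closure_add_facet x) O hO hxO
  rw [← hG.affineSpan_eq_top (hG_ne.image _), affineSpan_le]
  rintro _ ⟨u, hu, rfl⟩
  exact hUT ⟨u, hcU (hOc hu), v, hT hv, rfl⟩

theorem isSolidChimneyGerm_chimneyGerm (x : V) (ε ε' : ℤˣ) (w w' : D.weyl) (J' : Set ι) :
    𝔸.IsSolidChimneyGerm (𝔸.chimneyGerm x (D.chamber ε w) (D.facet ε' w' J')) :=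
  ⟨x, _, _, ⟨ε, w, w.2, ∅, rfl⟩, ⟨ε', w', w'.2, J', rfl⟩,
    𝔸.chimneySolid_of_support_eq_top
      (𝔸.support_chimney_chamber x ε w (D.nonempty_facet ε' w' J')), rfl⟩

theorem isSolidChimneyGerm_sectorGerm (ε : ℤˣ) (w : D.weyl) :
    𝔸.IsSolidChimneyGerm (sectorGerm (D.chamber ε w)) := by
  rw [← 𝔸.chimneyGerm_chamber 0 ε ε w w ∅]
  exact 𝔸.isSolidChimneyGerm_chimneyGerm 0 ε ε w w ∅

end Solidity

end AffineApartment

namespace AffineHovel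

open AffineApartment RootBasis VectorialWeylData

section Charts

variable {V ι I : Type*} [NormedAddCommGroup V] [NormedSpace ℝ V] [Fintype ι]
  {D : VectorialWeylData V ι} {𝔸 : AffineApartment D} (H : AffineHovel 𝔸 I)

theorem nonempty_sectorGerm [Nonempty I] (ε : ℤˣ) : Nonempty (H.SectorGerm ε) := by
  obtain ⟨x⟩ := ‹Nonempty I›
  obtain ⟨A, hA, -⟩ : x ∈ ⋃₀ H.apts := H.covering ▸ Set.mem_univ x
  obtain ⟨f, hf⟩ := H.isom_nonempty A hA
  exact ⟨⟨_, A, hA, f, hf, 1, rfl⟩⟩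

variable {H} {A A' : Set I} {f f' : V → I}

theorem apt_mem_map (hA : A ∈ H.apts) (hf : f ∈ H.isom A) (F : Filter V) : A ∈ map f F := by
  rw [← (H.isom_bijOn A hA f hf).2]
  exact range_mem_map

theorem chartGerm_injective (hA : A ∈ H.apts) (hf : f ∈ H.isom A) {ε : ℤˣ} {w w' : D.weyl}
    (h : chartGerm D f ε w = chartGerm D f ε w') : w' = w :=
  sectorGerm_injective ((map_inj (H.isom_bijOn A hA f hf).1).1 h)

theorem chartGerm_eq_of_eventually {g : V ≃ᵃ[ℝ] V} {u w : D.weyl} {ε : ℤˣ}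
    (hu : g.linear = u) (h : ∀ᶠ v in sectorGerm (D.chamber ε w), f' (g v) = f v) :
    chartGerm D f ε w = chartGerm D f' ε (u * w) := by
  have hchamber : D.chamber ε (u * w : D.weyl) = g.linear '' D.chamber ε w := by
    rw [hu]
    exact facet_mul _
  rw [chartGerm, chartGerm, hchamber, ← map_sectorGerm, map_map]
  exact (map_congr h).symm

theorem exists_chart_eq (hA : A ∈ H.apts) (hA' : A' ∈ H.apts) (hf : f ∈ H.isom A)
    {R F : Filter V} (hR : 𝔸.IsSplayedChimneyGerm R) (hF : 𝔸.IsSolidChimneyGerm F)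
    (hAR : A' ∈ map f R) (hAF : A' ∈ map f F) :
    ∃ f' ∈ H.isom A', ∀ᶠ v in 𝔸.cl (R ⊔ F), f' v = f v := by
  obtain ⟨-, φ, hφ, h⟩ := H.ma4 A hA f hf R F hR (Or.inr hF) A' hA' hAR hAF
  exact ⟨_, hφ, h⟩

theorem exists_transition (hA : A ∈ H.apts) (hA' : A' ∈ H.apts) (hf : f ∈ H.isom A)
    (hf' : f' ∈ H.isom A') {R F : Filter V} (hR : 𝔸.IsSplayedChimneyGerm R)
    (hF : 𝔸.IsSolidChimneyGerm F) (hAR : A' ∈ map f R) (hAF : A' ∈ map f F) :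
    ∃ (g : V ≃ᵃ[ℝ] V) (u : D.weyl), g.linear = u ∧ ∀ᶠ v in 𝔸.cl (R ⊔ F), f' (g v) = f v := by
  obtain ⟨f'', hf'', h⟩ := exists_chart_eq hA hA' hf hR hF hAR hAF
  obtain ⟨g, hg, rfl⟩ := (H.isom_iff A' hA' f' hf' f'').1 hf''
  exact ⟨g, ⟨g.linear, linear_mem_weyl 𝔸 hg⟩, rfl, h⟩

end Charts

section RelativePosition

variable {V ι I : Type*} [NormedAddCommGroup V] [NormedSpace ℝ V] [FiniteDimensional ℝ V]
  [Fintype ι] {D : VectorialWeylData V ι} {𝔸 : AffineApartment D} {H : AffineHovel 𝔸 I}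
  {ε ε₁ ε₂ : ℤˣ} {A A' : Set I} {f f' : V → I}

theorem exists_chart_eq_on_sectorGerm (hA : A ∈ H.apts) (hA' : A' ∈ H.apts) (hf : f ∈ H.isom A)
    {w : D.weyl} (h : A' ∈ chartGerm D f ε w) :
    ∃ f' ∈ H.isom A', ∀ᶠ v in sectorGerm (D.chamber ε w), f' v = f v := by
  obtain ⟨f', hf', heq⟩ := exists_chart_eq hA hA' hf (𝔸.isSplayedChimneyGerm_sectorGerm ε w)
    (𝔸.isSolidChimneyGerm_sectorGerm ε w) h h
  exact ⟨f', hf', heq.filter_mono (le_sup_left.trans (le_cl _))⟩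

theorem exists_eq_chartGerm (Q : H.SectorGerm ε) (hA : A ∈ H.apts) (hQ : A ∈ Q.1)
    (hf : f ∈ H.isom A) : ∃ w, Q.1 = chartGerm D f ε w := by
  obtain ⟨_, A₀, hA₀, f₀, hf₀, w₀, rfl⟩ := Q
  obtain ⟨g, u, hu, heq⟩ := exists_transition hA₀ hA hf₀ hf
    (𝔸.isSplayedChimneyGerm_sectorGerm ε w₀) (𝔸.isSolidChimneyGerm_sectorGerm ε w₀) hQ hQ
  exact ⟨u * w₀,
    chartGerm_eq_of_eventually hu (heq.filter_mono (le_sup_left.trans (le_cl _)))⟩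

theorem exists_common_apt (Q₁ : H.SectorGerm ε₁) (Q₂ : H.SectorGerm ε₂) :
    ∃ A ∈ H.apts, A ∈ Q₁.1 ∧ A ∈ Q₂.1 := by
  obtain ⟨_, A₁, hA₁, f₁, hf₁, w₁, rfl⟩ := Q₁
  obtain ⟨_, A₂, hA₂, f₂, hf₂, w₂, rfl⟩ := Q₂
  exact H.ma3 A₁ hA₁ f₁ hf₁ A₂ hA₂ f₂ hf₂ _ _ (𝔸.isSplayedChimneyGerm_sectorGerm ε₁ w₁)
    (Or.inr (𝔸.isSolidChimneyGerm_sectorGerm ε₂ w₂))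

theorem exists_readIn (Q₁ : H.SectorGerm ε₁) (Q₂ : H.SectorGerm ε₂) (hA : A ∈ H.apts)
    (h₁ : A ∈ Q₁.1) (h₂ : A ∈ Q₂.1) (hf : f ∈ H.isom A) :
    ∃ w₁ w₂, H.ReadIn Q₁ Q₂ A f w₁ w₂ := by
  obtain ⟨w₁, hw₁⟩ := exists_eq_chartGerm Q₁ hA h₁ hf
  obtain ⟨w₂, hw₂⟩ := exists_eq_chartGerm Q₂ hA h₂ hf
  exact ⟨w₁, w₂, hA, hf, hw₁, hw₂⟩

theorem exists_chart_readIn (Q₁ : H.SectorGerm ε₁) (Q₂ : H.SectorGerm ε₂) :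
    ∃ A f w₁ w₂, H.ReadIn Q₁ Q₂ A f w₁ w₂ := by
  obtain ⟨A, hA, h₁, h₂⟩ := exists_common_apt Q₁ Q₂
  obtain ⟨f, hf⟩ := H.isom_nonempty A hA
  obtain ⟨w₁, w₂, h⟩ := exists_readIn Q₁ Q₂ hA h₁ h₂ hf
  exact ⟨A, f, w₁, w₂, h⟩

variable {Q₁ : H.SectorGerm ε₁} {Q₂ : H.SectorGerm ε₂} {w₁ w₂ w₁' w₂' : D.weyl}

theorem ReadIn.inv_mul_eq (h : H.ReadIn Q₁ Q₂ A f w₁ w₂) (h' : H.ReadIn Q₁ Q₂ A' f' w₁' w₂') :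
    w₁⁻¹ * w₂ = w₁'⁻¹ * w₂' := by
  obtain ⟨hA, hf, h₁, h₂⟩ := h
  obtain ⟨hA', hf', h₁', h₂'⟩ := h'
  obtain ⟨g, u, hu, heq⟩ := exists_transition hA hA' hf hf'
    (𝔸.isSplayedChimneyGerm_sectorGerm ε₁ w₁) (𝔸.isSolidChimneyGerm_sectorGerm ε₂ w₂)
    (h₁.symm.trans h₁' ▸ apt_mem_map hA' hf' _ : A' ∈ chartGerm D f ε₁ w₁)
    (h₂.symm.trans h₂' ▸ apt_mem_map hA' hf' _ : A' ∈ chartGerm D f ε₂ w₂)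
  have hw₁ : u * w₁ = w₁' := chartGerm_injective hA' hf' <| h₁'.symm.trans <| h₁.trans <|
    chartGerm_eq_of_eventually hu (heq.filter_mono (le_sup_left.trans (le_cl _)))
  have hw₂ : u * w₂ = w₂' := chartGerm_injective hA' hf' <| h₂'.symm.trans <| h₂.trans <|
    chartGerm_eq_of_eventually hu (heq.filter_mono (le_sup_right.trans (le_cl _)))
  rw [← hw₁, ← hw₂]
  group

theorem ReadIn.relPos_eq (h : H.ReadIn Q₁ Q₂ A f w₁ w₂) : H.relPos Q₁ Q₂ = w₁⁻¹ * w₂ := by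
  have hex : ∃ u : D.weyl, ∃ A f w₁ w₂, H.ReadIn Q₁ Q₂ A f w₁ w₂ ∧ u = w₁⁻¹ * w₂ :=
    ⟨_, A, f, w₁, w₂, h, rfl⟩
  rw [relPos, dif_pos hex]
  obtain ⟨A', f', w₁', w₂', h', heq⟩ := hex.choose_spec
  rw [heq]
  exact h'.inv_mul_eq h

variable (H)

theorem relPos_inv (Q₁ : H.SectorGerm ε₁) (Q₂ : H.SectorGerm ε₂) :
    H.relPos Q₂ Q₁ = (H.relPos Q₁ Q₂)⁻¹ := by
  obtain ⟨A, f, w₁, w₂, h⟩ := exists_chart_readIn Q₁ Q₂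
  have hswap : H.ReadIn Q₂ Q₁ A f w₂ w₁ := ⟨h.1, h.2.1, h.2.2.2, h.2.2.1⟩
  rw [h.relPos_eq, hswap.relPos_eq, mul_inv_rev, inv_inv]

theorem relPos_eq_one_iff (Q₁ Q₂ : H.SectorGerm ε) : H.relPos Q₁ Q₂ = 1 ↔ Q₁ = Q₂ := by
  obtain ⟨A, f, w₁, w₂, h⟩ := exists_chart_readIn Q₁ Q₂
  rw [h.relPos_eq, inv_mul_eq_one]
  obtain ⟨hA, hf, h₁, h₂⟩ := h
  constructor
  · rintro rfl
    exact Subtype.ext (h₁.trans h₂.symm)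
  · rintro rfl
    exact chartGerm_injective hA hf (h₂.symm.trans h₁)

theorem exists_relPos_eq (Q : H.SectorGerm ε₁) (Q₁ : H.SectorGerm ε₂) (s : D.weyl) :
    ∃ Q₂ : H.SectorGerm ε₂, H.relPos Q₁ Q₂ = s ∧ H.relPos Q Q₂ = H.relPos Q Q₁ * s := by
  obtain ⟨A, f, w, w₁, h⟩ := exists_chart_readIn Q Q₁
  obtain ⟨hA, hf, hQ, hQ₁⟩ := id h
  let Q₂ : H.SectorGerm ε₂ := ⟨chartGerm D f ε₂ (w₁ * s), A, hA, f, hf, _, rfl⟩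
  have h₁₂ : H.ReadIn Q₁ Q₂ A f w₁ (w₁ * s) := ⟨hA, hf, hQ₁, rfl⟩
  have h₂ : H.ReadIn Q Q₂ A f w (w₁ * s) := ⟨hA, hf, hQ, rfl⟩
  exact ⟨Q₂, by rw [h₁₂.relPos_eq, inv_mul_cancel_left],
    by rw [h₂.relPos_eq, h.relPos_eq, mul_assoc]⟩

end RelativePosition

section Projections

variable {V ι I : Type*} [NormedAddCommGroup V] [NormedSpace ℝ V] [Fintype ι]
  {D : VectorialWeylData V ι} {𝔸 : AffineApartment D} {H : AffineHovel 𝔸 I}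
  {ε ε₁ ε₂ : ℤˣ} {A A' : Set I} {f f' : V → I} {w₂ : D.weyl} {i : ι} {p : V}

/-- `Y` is the projection of the sector germ `Q` onto the panel `ε₂ w₂ F^v({i})` of the chart `f'`:
in some apartment containing `Q` and the germ of the chimney of this direction based at the minimal
facet at `p`, it is the sector germ dominating the panel on the side of `Q`. The base point `p` is
a parameter because only the chimney germ, not the panel, makes sense in several apartments. -/
def IsProjection (Q : H.SectorGerm ε₁) (Y : H.SectorGerm ε₂) (f' : V → I) (w₂ : D.weyl) (i : ι)
    (p : V) : Prop :=
  ∃ A f w₁ w, H.ReadIn Q Y A f w₁ w ∧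
    (∀ᶠ v in 𝔸.chimneyGerm p (D.facet ε₂ w₂ Set.univ) (D.facet ε₂ w₂ {i}), f v = f' v) ∧
    D.facet ε₂ w {i} = D.facet ε₂ w₂ {i} ∧ D.SameSide ε₁ w₁ ε₂ w i

variable [FiniteDimensional ℝ V] {Q : H.SectorGerm ε₁} {Y Y' : H.SectorGerm ε₂}

theorem IsProjection.eq (h : H.IsProjection Q Y f' w₂ i p) (h' : H.IsProjection Q Y' f' w₂ i p) :
    Y = Y' := by
  obtain ⟨A, f, w₁, w, ⟨hA, hf, hQ, hY⟩, hff', hpanel, hside⟩ := h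
  obtain ⟨A₁, f₁, w₁', w', ⟨hA₁, hf₁, hQ', hY'⟩, hf₁f', hpanel', hside'⟩ := h'
  have hff₁ : ∀ᶠ v in 𝔸.chimneyGerm p (D.facet ε₂ w₂ Set.univ) (D.facet ε₂ w₂ {i}),
      f v = f₁ v := by
    filter_upwards [hff', hf₁f'] with v hv hv₁ using hv.trans hv₁.symm
  obtain ⟨g, u, hu, heq⟩ := exists_transition hA hA₁ hf hf₁
    (𝔸.isSplayedChimneyGerm_chimneyGerm p ε₂ ε₂ w₂ w₂ Set.univ (D.isSphericalType_singleton i))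
    (𝔸.isSolidChimneyGerm_sectorGerm ε₁ w₁) (map_congr hff₁ ▸ apt_mem_map hA₁ hf₁ _)
    (hQ.symm.trans hQ' ▸ apt_mem_map hA₁ hf₁ _ : A₁ ∈ chartGerm D f ε₁ w₁)
  have hw₁ : u * w₁ = w₁' := chartGerm_injective hA₁ hf₁ <| hQ'.symm.trans <| hQ.trans <|
    chartGerm_eq_of_eventually hu (heq.filter_mono (le_sup_right.trans (le_cl _)))
  have hfix : ∀ᶠ v in 𝔸.chimneyGerm p (D.facet ε₂ w₂ Set.univ) (D.facet ε₂ w₂ {i}), g v = v := by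
    filter_upwards [heq.filter_mono (le_sup_left.trans (le_cl _)), hff₁] with v hgv hv
    exact (H.isom_bijOn A₁ hA₁ f₁ hf₁).1 (hgv.trans hv)
  have hfix_panel : ∀ v ∈ D.facet ε₂ w₂ {i}, (u : V ≃ₗ[ℝ] V) v = v := fun v hv =>
    hu ▸ linear_apply_eq_of_eventually_chimneyGerm hfix hv
  have hupanel : D.facet ε₂ (u * w : D.weyl) {i} = D.facet ε₂ w' {i} := by
    rw [Subgroup.coe_mul, facet_mul, hpanel, hpanel']
    exact (Set.image_congr hfix_panel).trans (Set.image_id' _)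
  have hw : w' = u * w :=
    eq_of_sameSide (hw₁ ▸ hside.mul_left u) hside' hupanel
  refine Subtype.ext (hY.trans ?_)
  rw [hY', hw]
  exact chartGerm_eq_of_eventually hu
    (heq.filter_mono (hpanel ▸ sectorGerm_le_cl hside))

theorem exists_eventually_isProjection (hA' : A' ∈ H.apts) (hf' : f' ∈ H.isom A')
    (Q : H.SectorGerm ε₁) (ε ε₂ : ℤˣ) (w₂ : D.weyl) (i : ι) (p : V) :
    ∃ Y : H.SectorGerm ε₂, ∀ᶠ q in 𝓝[(fun v => p + v) '' closure (D.chamber ε w₂)] p,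
      H.IsProjection Q Y f' w₂ i q := by
  obtain ⟨A₀, hA₀, f₀, hf₀, w₀, hQ₀⟩ := Q.2
  have hsplayed := 𝔸.isSplayedChimneyGerm_chimneyGerm p ε ε₂ w₂ w₂ ∅
    (D.isSphericalType_singleton i)
  obtain ⟨A, hA, hAR, hAQ⟩ := H.ma3 A' hA' f' hf' A₀ hA₀ f₀ hf₀ _ _ hsplayed
    (Or.inr (𝔸.isSolidChimneyGerm_sectorGerm ε₁ w₀))
  obtain ⟨f, hf, heq⟩ := exists_chart_eq hA' hA hf' hsplayed
    (𝔸.isSolidChimneyGerm_chimneyGerm p ε ε₂ w₂ w₂ {i}) hAR hAR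
  obtain ⟨w₁, hw₁⟩ := exists_eq_chartGerm Q hA (hQ₀ ▸ hAQ) hf
  obtain ⟨w, hpanel, hside⟩ := D.exists_sameSide ε₁ ε₂ w₁ w₂ i
  refine ⟨⟨_, A, hA, f, hf, w, rfl⟩, ?_⟩
  filter_upwards [eventually_mem_chimneyGerm (heq.filter_mono (le_sup_left.trans (le_cl _)))
    (facet_univ_subset_closure_chamber ε₂)] with q hq
  exact ⟨A, f, w₁, w, ⟨hA, hf, hw₁, rfl⟩, hq, hpanel, hside⟩

theorem exists_eventually_nhdsWithin_isProjection_smul (hA' : A' ∈ H.apts)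
    (hf' : f' ∈ H.isom A') (Q : H.SectorGerm ε₁) (ε ε₂ : ℤˣ) (w₂ : D.weyl) (i : ι) {u : V}
    {t : ℝ} {s : Set ℝ} (hs : ∀ τ ∈ s, (τ - t) • u ∈ closure (D.chamber ε w₂)) :
    ∃ Y : H.SectorGerm ε₂, ∀ᶠ τ in 𝓝[s] t, H.IsProjection Q Y f' w₂ i (τ • u) := by
  obtain ⟨Y, hY⟩ := exists_eventually_isProjection hA' hf' Q ε ε₂ w₂ i (t • u)
  have hcont : ContinuousWithinAt (fun τ : ℝ => τ • u) s t := by fun_prop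
  have hmaps : Set.MapsTo (fun τ : ℝ => τ • u) s
      ((fun v => t • u + v) '' closure (D.chamber ε w₂)) := fun τ hτ =>
    ⟨_, hs τ hτ, by dsimp only; rw [← add_smul, add_sub_cancel]⟩
  exact ⟨Y, (hcont.tendsto_nhdsWithin hmaps).eventually hY⟩

theorem exists_eventually_isProjection_smul (hA' : A' ∈ H.apts) (hf' : f' ∈ H.isom A')
    (Q : H.SectorGerm ε₁) (i : ι) {u : V} (hu : u ∈ D.chamber ε₂ w₂) (t : ℝ) :
    ∃ Y : H.SectorGerm ε₂, ∀ᶠ τ in 𝓝 t, H.IsProjection Q Y f' w₂ i (τ • u) := by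
  have hpos := mem_chamber_iff.1 hu
  obtain ⟨Y, hY⟩ := exists_eventually_nhdsWithin_isProjection_smul hA' hf' Q ε₂ ε₂ w₂ i
    (u := u) (t := t) (s := Set.Ici t) fun τ hτ => mem_closure_chamber_iff.2 fun j => by
      rw [map_smul]
      exact mul_nonneg (sub_nonneg.2 hτ) (hpos j).le
  obtain ⟨Y', hY'⟩ := exists_eventually_nhdsWithin_isProjection_smul hA' hf' Q (-ε₂) ε₂ w₂ i
    (u := u) (t := t) (s := Set.Iic t) fun τ hτ => mem_closure_chamber_iff.2 fun j => by
      rw [signedRoot_neg, LinearMap.neg_apply, map_smul, ← smul_neg]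
      exact mul_nonneg_of_nonpos_of_nonpos (sub_nonpos.2 hτ) (neg_nonpos.2 (hpos j).le)
  obtain rfl : Y = Y' := (hY.self_of_nhdsWithin Set.self_mem_Ici).eq
    (hY'.self_of_nhdsWithin Set.self_mem_Iic)
  rw [← nhdsLE_sup_nhdsGE]
  exact ⟨Y, eventually_sup.2 ⟨hY', hY⟩⟩

theorem exists_forall_isProjection_smul (hA' : A' ∈ H.apts) (hf' : f' ∈ H.isom A')
    (Q : H.SectorGerm ε₁) (i : ι) {u : V} (hu : u ∈ D.chamber ε₂ w₂) :
    ∃ Y : H.SectorGerm ε₂, ∀ τ : ℝ, H.IsProjection Q Y f' w₂ i (τ • u) := by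
  choose Y hY using exists_eventually_isProjection_smul hA' hf' Q i hu
  have hlocal : IsLocallyConstant Y := (IsLocallyConstant.iff_eventually_eq Y).2 fun t => by
    filter_upwards [hY t] with τ hτ using (hY τ).self_of_nhds.eq hτ
  refine ⟨Y 0, fun τ => ?_⟩
  rw [hlocal.apply_eq_of_preconnectedSpace 0 τ]
  exact (hY τ).self_of_nhds

theorem exists_readIn_of_forall_isProjection (hA' : A' ∈ H.apts) (hf' : f' ∈ H.isom A')
    {u : V} (hY : ∀ τ : ℝ, H.IsProjection Q Y f' w₂ i (τ • u)) {Q' : H.SectorGerm ε₂}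
    {w' : D.weyl} (hQ' : Q'.1 = chartGerm D f' ε₂ w')
    (hpanel : D.facet ε₂ w' {i} = D.facet ε₂ w₂ {i}) (hu : D.signedRoot ε₂ w' i u ≠ 0) :
    ∃ A f w₁ w, H.ReadIn Q Y A f w₁ w ∧ H.ReadIn Q Q' A f w₁ w' ∧
      D.facet ε₂ w {i} = D.facet ε₂ w' {i} ∧ D.SameSide ε₁ w₁ ε₂ w i := by
  obtain ⟨A, hA, hAQ, hAQ'⟩ := exists_common_apt Q Q'
  obtain ⟨f, hf, hff'⟩ := exists_chart_eq_on_sectorGerm hA' hA hf' (hQ' ▸ hAQ')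
  obtain ⟨w₁, hw₁⟩ := exists_eq_chartGerm Q hA hAQ hf
  obtain ⟨w, hww', hside⟩ := D.exists_sameSide ε₁ ε₂ w₁ w' i
  obtain ⟨τ, hτ⟩ := exists_mem_chimneyGerm_smul (𝔸 := 𝔸) hff' hu (D.facet ε₂ w₂ Set.univ)
  let P : H.SectorGerm ε₂ := ⟨chartGerm D f ε₂ w, A, hA, f, hf, w, rfl⟩
  have hP : H.IsProjection Q P f' w₂ i (τ • u) :=
    ⟨A, f, w₁, w, ⟨hA, hf, hw₁, rfl⟩, hpanel ▸ hτ, hww'.trans hpanel, hside⟩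
  exact ⟨A, f, w₁, w, ⟨hA, hf, hw₁, congrArg Subtype.val ((hY τ).eq hP)⟩,
    ⟨hA, hf, hw₁, hQ'.trans (map_congr hff').symm⟩, hww', hside⟩

theorem exists_gate (hA' : A' ∈ H.apts) (hf' : f' ∈ H.isom A') (Q : H.SectorGerm ε₁)
    (w₂ : D.weyl) (i : ι) : ∃ Y : H.SectorGerm ε₂,
      (D.cs.length (H.relPos Q Y) < D.cs.length (H.relPos Q Y * D.simpleRefl i) ↔ ε₁ = ε₂) ∧
      ∀ (Q' : H.SectorGerm ε₂) (w' : D.weyl), Q'.1 = chartGerm D f' ε₂ w' →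
        D.facet ε₂ w' {i} = D.facet ε₂ w₂ {i} →
        Q' = Y ∨ H.relPos Q Q' = H.relPos Q Y * D.simpleRefl i := by
  obtain ⟨u, hu⟩ := D.nonempty_facet ε₂ w₂ ∅
  have hu₀ : D.signedRoot ε₂ w₂ i u ≠ 0 := (mem_chamber_iff.1 hu i).ne'
  obtain ⟨Y, hY⟩ := exists_forall_isProjection_smul hA' hf' Q i hu
  refine ⟨Y, ?_, fun Q' w' hQ' hpanel => ?_⟩
  · let Q₀ : H.SectorGerm ε₂ := ⟨chartGerm D f' ε₂ w₂, A', hA', f', hf', w₂, rfl⟩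
    obtain ⟨A, f, w₁, w, hread, -, -, hside⟩ :=
      exists_readIn_of_forall_isProjection hA' hf' hY (Q' := Q₀) rfl rfl hu₀
    rwa [hread.relPos_eq, ← sameSide_iff_length_lt]
  · have hu' : D.signedRoot ε₂ w' i u ≠ 0 := by
      rcases eq_or_eq_mul_simpleRefl_of_facet_eq hpanel.symm with rfl | rfl
      · exact hu₀
      · rw [coe_mul_simpleRefl, signedRoot_mul_refl_self]
        exact neg_ne_zero.2 hu₀
    obtain ⟨A, f, w₁, w, hread, hread', hww', -⟩ :=
      exists_readIn_of_forall_isProjection hA' hf' hY hQ' hpanel hu'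
    rcases eq_or_eq_mul_simpleRefl_of_facet_eq hww' with rfl | rfl
    · exact Or.inl (Subtype.ext (hread'.2.2.2.trans hread.2.2.2.symm))
    · exact Or.inr (by rw [hread.relPos_eq, hread'.relPos_eq, mul_assoc])

variable (H)

theorem relPos_adjacent (Q : H.SectorGerm ε₁) (Q₁ Q₂ : H.SectorGerm ε₂)
    (h : H.relPos Q₁ Q₂ = D.simpleRefl i) :
    (H.relPos Q Q₂ = H.relPos Q Q₁ ∨ H.relPos Q Q₂ = H.relPos Q Q₁ * D.simpleRefl i) ∧
    ((D.cs.length (H.relPos Q Q₁) < D.cs.length (H.relPos Q Q₁ * D.simpleRefl i) ↔ ε₁ = ε₂) →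
      H.relPos Q Q₂ = H.relPos Q Q₁ * D.simpleRefl i) := by
  have hne : Q₁ ≠ Q₂ := fun hQ => D.simpleRefl_ne_one i (h ▸ (H.relPos_eq_one_iff Q₁ Q₂).2 hQ)
  obtain ⟨A, f, w₁, w₂, hread⟩ := exists_chart_readIn Q₁ Q₂
  obtain rfl : w₂ = w₁ * D.simpleRefl i := by rw [← h, hread.relPos_eq, mul_inv_cancel_left]
  obtain ⟨hA, hf, hQ₁, hQ₂⟩ := hread
  obtain ⟨Y, hside, hgate⟩ := exists_gate hA hf Q w₁ i
  have hss : ∀ x : D.weyl, x * D.simpleRefl i * D.simpleRefl i = x := fun x => by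
    rw [mul_assoc, D.simpleRefl_mul_self, mul_one]
  rcases hgate Q₁ w₁ hQ₁ rfl with rfl | h₁
  · have h₂ := (hgate Q₂ _ hQ₂ (facet_mul_simpleRefl _ _ _)).resolve_left hne.symm
    exact ⟨Or.inr h₂, fun _ => h₂⟩
  rcases hgate Q₂ _ hQ₂ (facet_mul_simpleRefl _ _ _) with rfl | h₂
  · rw [h₁, hss]
    exact ⟨Or.inr rfl, fun _ => rfl⟩
  · rw [h₁, h₂, hss, length_mul_simpleRefl_lt_iff]
    exact ⟨Or.inl rfl, fun hlt => by tauto⟩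

theorem isBuilding_dist [Nonempty I] (ε : ℤˣ) : IsBuilding D.cs (H.dist ε) where
  nonempty := H.nonempty_sectorGerm ε
  eq_one_iff := H.relPos_eq_one_iff
  adjacent x y z i h := by
    rw [D.cs_simple] at h ⊢
    obtain ⟨hor, hup⟩ := H.relPos_adjacent x y z h
    exact ⟨hor, fun hlt => hup (iff_of_true hlt rfl)⟩
  exists_adjacent x y i := H.exists_relPos_eq x y (D.cs.simple i)

theorem isHalfTwinning_relPos (hε : ε₁ ≠ ε₂) :
    IsHalfTwinning D.cs (H.dist ε₂) (H.relPos (ε₁ := ε₁) (ε₂ := ε₂)) where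
  adjacent x y z i h hlt := by
    rw [D.cs_simple] at h hlt ⊢
    exact (H.relPos_adjacent x y z h).2 (iff_of_false hlt.not_gt hε)
  exists_adjacent x y i := H.exists_relPos_eq x y (D.cs.simple i)

end Projections

end AffineHovel

end

theorem mainTheorem3 {V ι I : Type*} [NormedAddCommGroup V] [NormedSpace ℝ V]
    [FiniteDimensional ℝ V] [Fintype ι] [Nonempty I]
    (D : VectorialWeylData V ι) (𝔸 : AffineApartment D) (H : AffineHovel 𝔸 I) :
    -- `d_+`, `d_-` and `d_*` are well defined
    (∀ (ε₁ ε₂ : ℤˣ) (Q₁ : H.SectorGerm ε₁) (Q₂ : H.SectorGerm ε₂),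
      (∃ A ∈ H.apts, A ∈ Q₁.1 ∧ A ∈ Q₂.1) ∧
      (∀ A ∈ H.apts, A ∈ Q₁.1 → A ∈ Q₂.1 → ∀ f ∈ H.isom A, ∃ w₁ w₂, H.ReadIn Q₁ Q₂ A f w₁ w₂) ∧
      (∀ A f w₁ w₂, H.ReadIn Q₁ Q₂ A f w₁ w₂ → H.relPos Q₁ Q₂ = w₁⁻¹ * w₂)) ∧
    -- `d_*` is a twinning between the buildings `(I^{+∞}, d_+)` and `(I^{-∞}, d_-)`
    IsTwinning D.cs (H.dist 1) (H.dist (-1)) H.codistPosNeg H.codistNegPos := by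
  refine ⟨fun ε₁ ε₂ Q₁ Q₂ => ⟨AffineHovel.exists_common_apt Q₁ Q₂,
    fun A hA h₁ h₂ f hf => AffineHovel.exists_readIn Q₁ Q₂ hA h₁ h₂ hf,
    fun A f w₁ w₂ h => h.relPos_eq⟩, ?_⟩
  exact
    { building := H.isBuilding_dist 1
      building' := H.isBuilding_dist (-1)
      symm := H.relPos_inv
      half := H.isHalfTwinning_relPos (by decide)
      half' := H.isHalfTwinning_relPos (by decide) }
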